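/- Let $\mathbb{D}$ be the unit disc, $\mathcal{H}(\mathbb{D})$ the space of analytic functions $f(z)=\sum_{n\ge 0}\widehat f(n)z^n$ in $\mathbb{D}$, and $dA=\frac{dx\,dy}{\pi}$. A radial weight is a function $\mu(z)=\mu(|z|)$, where $\mu\in L^1([0,1))$ is non-negative and $\widehat\mu(r)=\int_r^1\mu(s)\,ds>0$ for all $0<r<1$; we write $\widehat\mu(z)=\widehat\mu(|z|)$. We say $\mu\in\widehat{\mathcal{D}}$ if $\mu$ is a radial weight and there is $C>0$ with $\widehat\mu(r)\le C\,\widehat\mu\left(\frac{1+r}{2}\right)$ for all $0\le r<1$. Put $\mu_{2n+1}=\int_0^1 s^{2n+1}\mu(s)\,ds$ and $$D^\mu(f)(z)=\sum_{n=0}^\infty\frac{\widehat f(n)}{\mu_{2n+1}}z^n,\qquad f\in\mathcal{H}(\mathbb{D}),\ z\in\mathbb{D}.$$ For $0<p<\infty$ let $n_p$ be the least $n\in\mathbb{N}$ with $np>1$, and for $f\in\mathcal{H}(\mathbb{D})$ let $$\|f\|_{B_p}^p=\sum_{j=0}^{n_p-1}|f^{(j)}(0)|^p+\int_{\mathbb{D}}|f^{(n_p)}(z)|^p(1-|z|^2)^{n_pp-2}\,dA(z),$$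 $$\|f\|_{B_{p,\mu}}^p=\int_{\mathbb{D}}|D^\mu(f)(z)|^p\frac{\widehat\mu(z)^p}{(1-|z|^2)^2}\,dA(z),$$ values in $[0,\infty]$; $B_p$ and $B_{p,\mu}$ are the sets of $f\in\mathcal{H}(\mathbb{D})$ for which the respective quantity is finite. **Theorem.** Let $\mu$ be a radial weight and let $0<p<\infty$. Assume that either $1\le p<\infty$, or $0<p<1$ and $\mu\in\widehat{\mathcal{D}}$. Then $B_{p,\mu}\subset B_p$, and there is a constant $C=C(p,\mu)>0$ such that $$\|f\|_{B_p}^p\le C\,\|f\|_{B_{p,\mu}}^p,\qquad f\in\mathcal{H}(\mathbb{D}).$$ -/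

import Mathlib

open MeasureTheory
open scoped ENNReal NNReal

noncomputable section

namespace FracBesov

/-- The open unit disc of the complex plane. -/
def disc : Set ℂ := Metric.ball (0 : ℂ) 1

/-- The space `H(𝔻)` of analytic functions in the unit disc. A function is a total function
`ℂ → ℂ` of which only the values on the disc matter. -/
def HolDisc : Set (ℂ → ℂ) := {f | DifferentiableOn ℂ f disc}

/-- The normalized area measure `dA = dx dy / π` on the unit disc. -/
def areaDisc : Measure ℂ := (ENNReal.ofReal Real.pi)⁻¹ • volume.restrict disc

/-- The tail `μ̂(r) = ∫_r^1 μ(s) ds`. -/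
def tail (μ : ℝ → ℝ) (r : ℝ) : ℝ := ∫ s in r..1, μ s

/-- The (radial profile of a) radial weight: a non-negative integrable function on `[0,1)` with
`μ̂(r) > 0` for all `r ∈ (0,1)`. The weight on the disc is `z ↦ μ(|z|)`. -/
structure IsRadialWeight (μ : ℝ → ℝ) : Prop where
  nonneg : ∀ s ∈ Set.Ico (0 : ℝ) 1, 0 ≤ μ s
  integrable : IntegrableOn μ (Set.Ico (0 : ℝ) 1)
  tail_pos : ∀ r ∈ Set.Ioo (0 : ℝ) 1, 0 < tail μ r

/-- The class of radial weights with `μ̂(r) ≤ C μ̂((1+r)/2)` for `0 ≤ r < 1`. -/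
def UpperDoubling : Set (ℝ → ℝ) :=
  {μ | IsRadialWeight μ ∧
    ∃ C : ℝ, 0 < C ∧ ∀ r ∈ Set.Ico (0 : ℝ) 1, tail μ r ≤ C * tail μ ((1 + r) / 2)}

/-- The moment `μ_k = ∫_0^1 s^k μ(s) ds`. -/
def moment (μ : ℝ → ℝ) (k : ℕ) : ℝ := ∫ s in (0 : ℝ)..1, s ^ k * μ s

/-- The Taylor coefficient of `f` at the origin. -/
def taylorCoeff (f : ℂ → ℂ) (n : ℕ) : ℂ := iteratedDeriv n f 0 / (Nat.factorial n : ℂ)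

/-- The fractional derivative `D^μ(f)(z) = ∑ f̂(n) / μ_{2n+1} z^n` (the series converges for every
`z` in the disc when `μ` is a radial weight and `f` is analytic in the disc). -/
def fracDeriv (μ : ℝ → ℝ) (f : ℂ → ℂ) (z : ℂ) : ℂ :=
  ∑' n : ℕ, taylorCoeff f n / (moment μ (2 * n + 1) : ℂ) * z ^ n

/-- The least natural number `n` with `n p > 1`. -/
def besovOrder (p : ℝ) : ℕ := sInf {n : ℕ | 1 < (n : ℝ) * p}

/-- The `p`-th power of the norm of the classical Besov space `B_p`, with value `∞` allowed. -/
def besovNormPow (p : ℝ) (f : ℂ → ℂ) : ℝ≥0∞ :=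
  ∑ j ∈ Finset.range (besovOrder p), ENNReal.ofReal (‖iteratedDeriv j f 0‖ ^ p) +
    ∫⁻ z, ENNReal.ofReal (‖iteratedDeriv (besovOrder p) f z‖ ^ p *
      (1 - ‖z‖ ^ 2) ^ ((besovOrder p : ℝ) * p - 2)) ∂areaDisc

/-- The classical Besov space `B_p`. -/
def BesovSpace (p : ℝ) : Set (ℂ → ℂ) := {f | f ∈ HolDisc ∧ besovNormPow p f < ∞}

/-- The `p`-th power of the norm of the fractional derivative Besov space `B_{p,μ}`, with value
`∞` allowed. -/
def fracBesovNormPow (p : ℝ) (μ : ℝ → ℝ) (f : ℂ → ℂ) : ℝ≥0∞ :=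
  ∫⁻ z, ENNReal.ofReal (‖fracDeriv μ f z‖ ^ p * (tail μ ‖z‖ ^ p / (1 - ‖z‖ ^ 2) ^ 2)) ∂areaDisc

/-- The fractional derivative Besov space `B_{p,μ}`. -/
def FracBesovSpace (p : ℝ) (μ : ℝ → ℝ) : Set (ℂ → ℂ) :=
  {f | f ∈ HolDisc ∧ fracBesovNormPow p μ f < ∞}

end FracBesov

end

namespace FracBesov

/-! Put g = D^μ(f) and n = n_p. Integrating Taylor series against μ gives f⁽ⁿ⁾(z) = ∫₀¹ s^{2n+1}
μ(s) g⁽ⁿ⁾(s²z) ds (`IsRadialWeight.iteratedDeriv_eq_integral`), so the task is a weighted L^p bound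
for averages of dilations of g⁽ⁿ⁾.

The range s < 1/2 only sees g⁽ⁿ⁾ on |u| ≤ 1/4, where the norm of f in B_{p,μ} controls it. The range
s ≥ 1/2 is cut at the scales D_i = (5/4)^i (1-|z|): on the i-th piece J_i one has 1-s ≤ 4D_i/5, with
1-s comparable to D_i if i ≥ 1. A sub-mean value inequality on the disc of radius D_i/10 about s²z
bounds |g⁽ⁿ⁾(s²z)|^p by D_i^{-(np+2)} ∫|g|^p.

The crucial point is that this disc lies in |w| ≤ 1-4D_i/5, while J_i lies in [1-4D_i/5, 1). Hence
the μ-mass of J_i is at most μ̂(1-4D_i/5) ≤ μ̂(|w|), and the factor μ̂(|w|)^p enters the integral by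
monotonicity alone (`IsRadialWeight.exists_lintegral_dilation_le`). The room for this comes from the
square in s²z: for s ≥ 1/2, 1-s² ≥ (3/2)(1-s), which beats the ratio 5/4 of the scales.

It remains to sum. The p-th power goes inside the sum over i at the price of a factor q^i with q > 1
(`exists_tsum_rpow_le`). Tonelli gives the i-th term a factor (5/4)^{-i(np-1)}
(`lintegral_lintegral_nearSet_le`), and np > 1 makes the series converge. Every p > 0 is treated in
the same way. -/

/-! ### Polar coordinates and sub-mean value inequalities -/

theorem lintegral_eq_lintegral_circleMap (c : ℂ) {F : ℂ → ℝ≥0∞} (hF : Measurable F) :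
    ∫⁻ z, F z = ∫⁻ r in Set.Ioi (0 : ℝ), ENNReal.ofReal r *
      ∫⁻ θ in Set.Ioo (-Real.pi) Real.pi, F (circleMap c r θ) := by
  have hcont : Continuous fun q : ℝ × ℝ => circleMap c q.1 q.2 := by
    simp only [circleMap]; fun_prop
  have hm : Measurable fun q : ℝ × ℝ => F (circleMap c q.1 q.2) := hF.comp hcont.measurable
  calc ∫⁻ z, F z = ∫⁻ z, F (c + z) := (lintegral_add_left_eq_self F c).symm
    _ = ∫⁻ q in polarCoord.target, ENNReal.ofReal q.1 * F (circleMap c q.1 q.2) := by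
        rw [← Complex.lintegral_comp_polarCoord_symm]
        refine lintegral_congr fun q => ?_
        simp [circleMap, Complex.exp_mul_I]
    _ = _ := by
        rw [polarCoord_target, Measure.volume_eq_prod, ← Measure.prod_restrict,
          lintegral_prod _ (by fun_prop)]
        refine lintegral_congr fun r => ?_
        dsimp only
        rw [lintegral_const_mul]
        exact hm.comp (by fun_prop : Measurable fun θ : ℝ => (r, θ))

/-- The mean value inequality for the norm of a holomorphic function over a circle. -/
theorem enorm_le_lintegral_circleMap {g : ℂ → ℂ} {u : ℂ} {r : ℝ} (hr : 0 < r)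
    (hg : DifferentiableOn ℂ g (Metric.closedBall u r)) :
    ENNReal.ofReal (2 * Real.pi) * ‖g u‖ₑ ≤
      ∫⁻ θ in Set.Ioo (-Real.pi) Real.pi, ‖g (circleMap u r θ)‖ₑ := by
  have hav : Real.circleAverage g u r = g u :=
    DiffContOnCl.circleAverage (by
      rw [abs_of_pos hr]; exact (hg.mono Metric.closure_ball_subset_closedBall).diffContOnCl)
  -- Circle averages run over (0, 2π), polar coordinates over (-π, π); periodicity reconciles them.
  have hper : ∫ θ in (0 : ℝ)..2 * Real.pi, g (circleMap u r θ) =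
      ∫ θ in (-Real.pi)..Real.pi, g (circleMap u r θ) := by
    have := ((periodic_circleMap u r).comp g).intervalIntegral_add_eq 0 (-Real.pi)
    simp only [Function.comp_apply] at this
    rw [zero_add] at this
    rw [this]; congr 1; ring
  have h2 : (2 * Real.pi : ℝ) • g u = ∫ θ in (-Real.pi)..Real.pi, g (circleMap u r θ) := by
    rw [← hper, ← hav, Real.circleAverage, smul_smul, mul_inv_cancel₀ (by positivity), one_smul]
  rw [intervalIntegral.integral_of_le (by linarith [Real.pi_pos]),
    integral_Ioc_eq_integral_Ioo] at h2
  calc ENNReal.ofReal (2 * Real.pi) * ‖g u‖ₑ = ‖(2 * Real.pi : ℝ) • g u‖ₑ := by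
        rw [enorm_smul, Real.enorm_of_nonneg (by positivity)]
    _ ≤ _ := by rw [h2]; exact enorm_integral_le_lintegral_enorm _

/-- The mean value inequality for the norm of a holomorphic function over a disc. -/
theorem enorm_le_lintegral_ball {g : ℂ → ℂ} {u : ℂ} {ρ : ℝ} (hρ : 0 < ρ)
    (hg : DifferentiableOn ℂ g (Metric.ball u ρ)) :
    ENNReal.ofReal (Real.pi * ρ ^ 2) * ‖g u‖ₑ ≤ ∫⁻ z in Metric.ball u ρ, ‖g z‖ₑ := by
  have hmeas : Measurable ((Metric.ball u ρ).indicator fun z => ‖g z‖ₑ) := by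
    classical
    rw [← Set.piecewise_eq_indicator]
    exact hg.continuousOn.enorm.measurable_piecewise continuousOn_const
      Metric.isOpen_ball.measurableSet
  rw [← lintegral_indicator Metric.isOpen_ball.measurableSet,
    lintegral_eq_lintegral_circleMap u hmeas]
  calc ENNReal.ofReal (Real.pi * ρ ^ 2) * ‖g u‖ₑ
      = ∫⁻ r in Set.Ioo 0 ρ, ENNReal.ofReal r * (ENNReal.ofReal (2 * Real.pi) * ‖g u‖ₑ) := by
        rw [lintegral_mul_const _ (by fun_prop), ← mul_assoc]
        congr 1
        have hint : IntegrableOn (fun r : ℝ => r) (Set.Ioo 0 ρ) :=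
          (continuous_id.integrableOn_Icc (a := 0) (b := ρ)).mono_set Set.Ioo_subset_Icc_self
        rw [← ofReal_integral_eq_lintegral_ofReal hint
          ((ae_restrict_iff' measurableSet_Ioo).2 (.of_forall fun r hr => hr.1.le)),
          ← integral_Ioc_eq_integral_Ioo, ← intervalIntegral.integral_of_le hρ.le, integral_id,
          ← ENNReal.ofReal_mul (by nlinarith)]
        congr 1; ring
    _ ≤ ∫⁻ r in Set.Ioo 0 ρ, ENNReal.ofReal r * ∫⁻ θ in Set.Ioo (-Real.pi) Real.pi,
          (Metric.ball u ρ).indicator (fun z => ‖g z‖ₑ) (circleMap u r θ) := by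
        refine setLIntegral_mono' measurableSet_Ioo fun r hr => ?_
        gcongr
        have hb : ∀ θ, circleMap u r θ ∈ Metric.ball u ρ := fun θ => by
          simp [Metric.mem_ball, dist_eq_norm, abs_of_pos hr.1, hr.2]
        simp only [Set.indicator_of_mem (hb _)]
        exact enorm_le_lintegral_circleMap hr.1
          (hg.mono (Metric.closedBall_subset_ball hr.2))
    _ ≤ _ := lintegral_mono_set Set.Ioo_subset_Ioi_self

/-- Subharmonicity of |g|^p is avoided by a maximum trick. At a maximum point v of (ρ - |v-u|)^{2/p}
|g(v)|, the values of |g| on a disc of half the remaining radius are at most 2^{2/p} |g(v)|. Writing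
|g| = |g|^{1-p} |g|^p there turns the mean value inequality for |g| at v into one for |g|^p, and
maximality carries it back to u. -/
theorem rpow_enorm_le_lintegral_ball_of_le_one {p : ℝ} (hp : 0 < p) (hp1 : p ≤ 1) {g : ℂ → ℂ}
    {u : ℂ} {ρ : ℝ} (hρ : 0 < ρ) (hg : DifferentiableOn ℂ g (Metric.closedBall u ρ)) :
    ENNReal.ofReal (ρ ^ 2) * ‖g u‖ₑ ^ p ≤
      ENNReal.ofReal (2 ^ (2 / p) / Real.pi) * ∫⁻ z in Metric.ball u ρ, ‖g z‖ₑ ^ p := by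
  have hcont : ContinuousOn (fun v => (ρ - dist v u) ^ (2 / p) * ‖g v‖)
      (Metric.closedBall u ρ) :=
    ContinuousOn.mul (ContinuousOn.rpow_const (by fun_prop) fun _ _ => Or.inr (by positivity))
      hg.continuousOn.norm
  obtain ⟨v, hv, hmax⟩ := (isCompact_closedBall u ρ).exists_isMaxOn
    ⟨u, Metric.mem_closedBall_self hρ.le⟩ hcont
  have hmax' : ∀ w ∈ Metric.closedBall u ρ,
      (ρ - dist w u) ^ (2 / p) * ‖g w‖ ≤ (ρ - dist v u) ^ (2 / p) * ‖g v‖ := fun w hw => hmax hw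
  have hu := hmax' u (Metric.mem_closedBall_self hρ.le)
  rw [dist_self, sub_zero] at hu
  rcases eq_or_ne (g u) 0 with h0 | h0
  · simp [h0, hp]
  have hpos : 0 < (ρ - dist v u) ^ (2 / p) * ‖g v‖ :=
    lt_of_lt_of_le (mul_pos (by positivity) (norm_pos_iff.2 h0)) hu
  have hvd : dist v u ≤ ρ := hv
  have hvρ : 0 < ρ - dist v u := by
    rcases hvd.lt_or_eq with h | h
    · linarith
    · rw [h, sub_self, Real.zero_rpow (by positivity), zero_mul] at hpos
      exact absurd hpos (lt_irrefl _)
  have hgv : 0 < ‖g v‖ := by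
    by_contra h
    have : ‖g v‖ = 0 := le_antisymm (not_lt.1 h) (norm_nonneg _)
    rw [this, mul_zero] at hpos
    exact lt_irrefl _ hpos
  set κ := (ρ - dist v u) / 2 with hκ
  have hκ0 : 0 < κ := by positivity
  have hκ2 : ρ - dist v u = 2 * κ := by rw [hκ]; ring
  have hsub : Metric.ball v κ ⊆ Metric.ball u ρ := fun w hw => by
    have h1 := dist_triangle w v u
    have h2 : dist w v < κ := hw
    rw [Metric.mem_ball]; linarith
  have hlocal : ∀ w ∈ Metric.ball v κ, ‖g w‖ ≤ 2 ^ (2 / p) * ‖g v‖ := fun w hw => by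
    have h1 := hmax' w (Metric.ball_subset_closedBall (hsub hw))
    have h2 : dist w v < κ := hw
    have h3 : κ ≤ ρ - dist w u := by linarith [dist_triangle w v u]
    rw [hκ2, Real.mul_rpow zero_le_two hκ0.le] at h1
    have h4 : κ ^ (2 / p) * ‖g w‖ ≤ κ ^ (2 / p) * (2 ^ (2 / p) * ‖g v‖) := by
      calc κ ^ (2 / p) * ‖g w‖ ≤ (ρ - dist w u) ^ (2 / p) * ‖g w‖ := by gcongr
        _ ≤ _ := by rw [← mul_assoc, mul_comm (κ ^ _)]; exact h1
    exact le_of_mul_le_mul_left h4 (by positivity)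
  have hmean := enorm_le_lintegral_ball hκ0
    (hg.mono (hsub.trans Metric.ball_subset_closedBall))
  set I := ∫⁻ z in Metric.ball u ρ, ‖g z‖ₑ ^ p
  -- interpolate between the supremum near `v` and the `p`-th power integral
  have hinterp : ENNReal.ofReal (Real.pi * κ ^ 2) * ‖g v‖ₑ ≤
      ENNReal.ofReal ((2 ^ (2 / p) * ‖g v‖) ^ (1 - p)) * I := by
    refine hmean.trans ?_
    calc ∫⁻ z in Metric.ball v κ, ‖g z‖ₑ
        ≤ ∫⁻ z in Metric.ball v κ,
            ENNReal.ofReal ((2 ^ (2 / p) * ‖g v‖) ^ (1 - p)) * ‖g z‖ₑ ^ p := by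
          refine setLIntegral_mono' Metric.isOpen_ball.measurableSet fun w hw => ?_
          have hw' := hlocal w hw
          rw [← ofReal_norm, ENNReal.ofReal_rpow_of_nonneg (norm_nonneg _) hp.le,
            ← ENNReal.ofReal_mul (by positivity)]
          apply ENNReal.ofReal_le_ofReal
          rcases (norm_nonneg (g w)).eq_or_lt with h | h
          · rw [← h]; positivity
          · calc ‖g w‖ = ‖g w‖ ^ (1 - p) * ‖g w‖ ^ p := by
                  rw [← Real.rpow_add h]; simp
              _ ≤ _ := by gcongr
      _ = ENNReal.ofReal ((2 ^ (2 / p) * ‖g v‖) ^ (1 - p)) *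
            ∫⁻ z in Metric.ball v κ, ‖g z‖ₑ ^ p :=
          lintegral_const_mul' _ _ ENNReal.ofReal_ne_top
      _ ≤ _ := by gcongr; exact lintegral_mono_set hsub
  rcases eq_or_ne I ⊤ with hI | hI
  · rw [hI, ENNReal.mul_top]
    · exact le_top
    · have : 0 < (2 : ℝ) ^ (2 / p) / Real.pi := by positivity
      simpa only [ne_eq, ENNReal.ofReal_eq_zero, not_le] using this
  have hinterp' : Real.pi * κ ^ 2 * ‖g v‖ ≤ (2 ^ (2 / p) * ‖g v‖) ^ (1 - p) * I.toReal := by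
    rw [← ENNReal.ofReal_toReal hI, ← ofReal_norm, ← ENNReal.ofReal_mul (by positivity),
      ← ENNReal.ofReal_mul (by positivity), ENNReal.ofReal_le_ofReal_iff (by positivity)] at hinterp
    exact hinterp
  have hpow : Real.pi * κ ^ 2 * ‖g v‖ ^ p ≤ 2 ^ (2 / p) / 4 * I.toReal := by
    have h2p : ((2 : ℝ) ^ (2 / p)) ^ (1 - p) = 2 ^ (2 / p) / 4 := by
      rw [← Real.rpow_mul zero_le_two, mul_sub, mul_one, div_mul_cancel₀ _ hp.ne',
        Real.rpow_sub two_pos]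
      norm_num
    rw [Real.mul_rpow (by positivity) hgv.le, h2p] at hinterp'
    have hsplit : ‖g v‖ = ‖g v‖ ^ (1 - p) * ‖g v‖ ^ p := by rw [← Real.rpow_add hgv]; simp
    have hq : 0 < ‖g v‖ ^ (1 - p) := by positivity
    refine le_of_mul_le_mul_left ?_ hq
    calc ‖g v‖ ^ (1 - p) * (Real.pi * κ ^ 2 * ‖g v‖ ^ p) = Real.pi * κ ^ 2 * ‖g v‖ := by
          conv_rhs => rw [hsplit]
          ring
      _ ≤ _ := hinterp'.trans_eq (by ring)
  have hup : ρ ^ 2 * ‖g u‖ ^ p ≤ 4 * κ ^ 2 * ‖g v‖ ^ p := by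
    have h1 := Real.rpow_le_rpow (by positivity) hu hp.le
    rw [Real.mul_rpow (by positivity) (norm_nonneg _), Real.mul_rpow (by positivity)
      (norm_nonneg _), ← Real.rpow_mul hρ.le, ← Real.rpow_mul (by positivity),
      div_mul_cancel₀ _ hp.ne', hκ2, Real.rpow_two, Real.rpow_two] at h1
    linarith
  rw [← ENNReal.ofReal_toReal hI, ← ofReal_norm, ENNReal.ofReal_rpow_of_nonneg (norm_nonneg _) hp.le,
    ← ENNReal.ofReal_mul (by positivity), ← ENNReal.ofReal_mul (by positivity)]
  apply ENNReal.ofReal_le_ofReal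
  have hpi := Real.pi_pos
  rw [div_mul_eq_mul_div, le_div_iff₀ hpi]
  nlinarith

/-- The sub-mean value inequality for `|g|^p`, `0 < p < ∞`, with a constant. -/
theorem exists_rpow_enorm_le_lintegral_ball {p : ℝ} (hp : 0 < p) :
    ∃ C : ℝ, 0 < C ∧ ∀ (g : ℂ → ℂ) (u : ℂ) (ρ : ℝ), 0 < ρ →
      DifferentiableOn ℂ g (Metric.closedBall u ρ) →
      ENNReal.ofReal (ρ ^ 2) * ‖g u‖ₑ ^ p ≤
        ENNReal.ofReal C * ∫⁻ z in Metric.ball u ρ, ‖g z‖ₑ ^ p := by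
  obtain ⟨m, hm⟩ := exists_nat_ge p
  have hm0 : (0 : ℝ) < m := hp.trans_le hm
  have hq : 0 < p / m := div_pos hp hm0
  refine ⟨2 ^ (2 / (p / m)) / Real.pi, by positivity, fun g u ρ hρ hg => ?_⟩
  -- For large p, use the holomorphic power g^m with exponent p/m ≤ 1.
  have h := rpow_enorm_le_lintegral_ball_of_le_one hq ((div_le_one hm0).2 hm) hρ (hg.pow m)
  have hconv : ∀ z, ‖(g ^ m) z‖ₑ ^ (p / m) = ‖g z‖ₑ ^ p := fun z => by
    rw [Pi.pow_apply, enorm_pow, ← ENNReal.rpow_natCast, ← ENNReal.rpow_mul,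
      mul_div_cancel₀ _ hm0.ne']
  simpa only [hconv] using h

/-- The sub-mean value inequality for the `p`-th power of the modulus of a derivative. -/
theorem exists_rpow_enorm_iteratedDeriv_le {p : ℝ} (hp : 0 < p) (n : ℕ) :
    ∃ C : ℝ, 0 < C ∧ ∀ (g : ℂ → ℂ) (u : ℂ) (ρ : ℝ), 0 < ρ →
      DifferentiableOn ℂ g (Metric.closedBall u ρ) →
      ‖iteratedDeriv n g u‖ₑ ^ p ≤ ENNReal.ofReal (C * ρ ^ (-(n * p + 2))) *
        ∫⁻ z in Metric.ball u ρ, ‖g z‖ₑ ^ p := by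
  obtain ⟨C, hC, hCg⟩ := exists_rpow_enorm_le_lintegral_ball hp
  refine ⟨(n.factorial) ^ p * 2 ^ (n * p + 2) * C, by positivity, fun g u ρ hρ hg => ?_⟩
  set I := ∫⁻ z in Metric.ball u ρ, ‖g z‖ₑ ^ p
  rcases eq_or_ne I ⊤ with hI | hI
  · rw [hI, ENNReal.mul_top]
    · exact le_top
    · have : 0 < (n.factorial : ℝ) ^ p * 2 ^ (n * p + 2) * C * ρ ^ (-(n * p + 2)) := by positivity
      simpa only [ne_eq, ENNReal.ofReal_eq_zero, not_le] using this
  have hρ2 : 0 < ρ / 2 := by positivity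
  -- Half of the radius serves the sub-mean value inequality on the circle |w-u| = ρ/2, the other
  -- half Cauchy's estimate.
  have hsph : ∀ w ∈ Metric.sphere u (ρ / 2),
      ‖g w‖ ≤ ((ρ / 2) ^ (-2 : ℝ) * (C * I.toReal)) ^ (1 / p) := fun w hw => by
    have hw' : dist w u = ρ / 2 := hw
    have hsub : Metric.closedBall w (ρ / 2) ⊆ Metric.closedBall u ρ :=
      Metric.closedBall_subset_closedBall' (by linarith)
    have hsub' : Metric.ball w (ρ / 2) ⊆ Metric.ball u ρ :=
      Metric.ball_subset_ball' (by linarith)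
    have h := (hCg g w (ρ / 2) hρ2 (hg.mono hsub)).trans
      (mul_le_mul_right (lintegral_mono_set hsub') _)
    change _ ≤ _ * I at h
    rw [← ENNReal.ofReal_toReal hI, ← ofReal_norm, ENNReal.ofReal_rpow_of_nonneg (norm_nonneg _)
      hp.le, ← ENNReal.ofReal_mul (by positivity), ← ENNReal.ofReal_mul (by positivity),
      ENNReal.ofReal_le_ofReal_iff (by positivity)] at h
    rw [← Real.rpow_le_rpow_iff (norm_nonneg _) (by positivity) hp, ← Real.rpow_mul (by positivity),
      one_div_mul_cancel hp.ne', Real.rpow_one, Real.rpow_neg hρ2.le, Real.rpow_two,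
      ← div_eq_inv_mul, le_div_iff₀ (by positivity), mul_comm]
    exact h
  have hcau := Complex.norm_iteratedDeriv_le_of_forall_mem_sphere_norm_le n hρ2
    ((hg.mono ((Metric.closure_ball_subset_closedBall).trans
      (Metric.closedBall_subset_closedBall (by linarith)))).diffContOnCl) hsph
  rw [← ENNReal.ofReal_toReal hI, ← ofReal_norm, ENNReal.ofReal_rpow_of_nonneg (norm_nonneg _)
    hp.le, ← ENNReal.ofReal_mul (by positivity)]
  apply ENNReal.ofReal_le_ofReal
  calc ‖iteratedDeriv n g u‖ ^ p ≤ _ := Real.rpow_le_rpow (norm_nonneg _) hcau hp.le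
    _ = (n.factorial : ℝ) ^ p * ((ρ / 2) ^ (-2 : ℝ) * (C * I.toReal)) / (ρ / 2) ^ (n * p) := by
      rw [Real.div_rpow (by positivity) (by positivity), Real.mul_rpow (by positivity)
        (by positivity), ← Real.rpow_mul (by positivity), one_div_mul_cancel hp.ne',
        Real.rpow_one, ← Real.rpow_natCast, ← Real.rpow_mul hρ2.le]
    _ = (n.factorial : ℝ) ^ p * (C * I.toReal) * (ρ / 2) ^ (-(n * p + 2)) := by
      rw [neg_add, Real.rpow_add hρ2, Real.rpow_neg hρ2.le (n * p)]; ring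
    _ = _ := by
      rw [Real.div_rpow hρ.le zero_le_two, Real.rpow_neg zero_le_two, div_inv_eq_mul]; ring

/-! ### Area estimates and power weights -/

/-- The arc of the circle of radius `r` lying within distance `η` of a point has angular measure
at most a constant times `η / r`. -/
theorem volume_arc_le {r η : ℝ} (hr : 0 < r) (w : ℂ) :
    volume {θ ∈ Set.Ioo (-Real.pi) Real.pi | dist (circleMap 0 r θ) w < η} ≤
      ENNReal.ofReal (6 * Real.pi * η / r) := by
  set S := {θ ∈ Set.Ioo (-Real.pi) Real.pi | dist (circleMap 0 r θ) w < η}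
  rcases S.eq_empty_or_nonempty with h | ⟨θ₀, hθ₀, hd₀⟩
  · simp [h]
  have hη : 0 < η := dist_nonneg.trans_lt hd₀
  have hπ := Real.pi_pos
  set κ := Real.pi * η / r with hκ
  have hκ0 : 0 < κ := by positivity
  -- Jordan's inequality sin y ≥ 2y/π converts chord length into angle.
  have hkey : ∀ y, 0 ≤ y → y ≤ Real.pi / 2 → Real.sin y < η / r → 2 * y < κ := by
    intro y h0 h1 h2
    have h3 := (Real.mul_le_sin h0 h1).trans_lt h2
    have h4 : 2 * y = Real.pi * (2 / Real.pi * y) := by field_simp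
    rw [h4, hκ, mul_div_assoc]
    gcongr
  -- Two angles in (-π, π) may differ by nearly 2π and still give close points, hence the two
  -- translated intervals.
  have hsub : S ⊆ Metric.ball θ₀ κ ∪ (Metric.ball (θ₀ + 2 * Real.pi) κ ∪
      Metric.ball (θ₀ - 2 * Real.pi) κ) := by
    rintro θ ⟨hθ, hd⟩
    have hd2 : ‖circleMap 0 r θ - circleMap 0 r θ₀‖ < 2 * η := by
      rw [← dist_eq_norm]
      linarith [dist_triangle_right (circleMap 0 r θ) (circleMap 0 r θ₀) w]
    have heq : ‖circleMap 0 r θ - circleMap 0 r θ₀‖ = r * (2 * |Real.sin ((θ - θ₀) / 2)|) := by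
      have h1 : circleMap 0 r θ - circleMap 0 r θ₀ =
          r * (Complex.exp (θ₀ * Complex.I) *
            (Complex.exp (Complex.I * ((θ - θ₀ : ℝ) : ℂ)) - 1)) := by
        simp only [circleMap_zero]
        rw [mul_sub, ← Complex.exp_add]
        push_cast
        ring_nf
      rw [h1, norm_mul, norm_mul, Complex.norm_exp_ofReal_mul_I,
        Complex.norm_exp_I_mul_ofReal_sub_one, Complex.norm_real, Real.norm_of_nonneg hr.le,
        norm_mul, one_mul, Real.norm_eq_abs, Real.norm_eq_abs, abs_two]
    have habs : |Real.sin ((θ - θ₀) / 2)| = Real.sin (|θ - θ₀| / 2) := by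
      have h2 : |θ - θ₀| < 2 * Real.pi := by
        rw [abs_lt]; constructor <;> linarith [hθ.1, hθ.2, hθ₀.1, hθ₀.2]
      have h3 : 0 ≤ Real.sin (|θ - θ₀| / 2) :=
        Real.sin_nonneg_of_nonneg_of_le_pi (by positivity) (by linarith)
      rw [← abs_of_nonneg h3]
      rcases abs_choice (θ - θ₀) with h | h <;> rw [h]
      rw [neg_div, Real.sin_neg, abs_neg]
    rw [heq, habs] at hd2
    have hsin : Real.sin (|θ - θ₀| / 2) < η / r := by
      rw [lt_div_iff₀ hr]; linarith
    rcases le_total (|θ - θ₀| / 2) (Real.pi / 2) with hle | hle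
    · left
      rw [Metric.mem_ball, Real.dist_eq]
      linarith [hkey _ (by positivity) hle hsin]
    · right
      have h2 : |θ - θ₀| < 2 * Real.pi := by
        rw [abs_lt]; constructor <;> linarith [hθ.1, hθ.2, hθ₀.1, hθ₀.2]
      rw [← Real.sin_pi_sub] at hsin
      have h5 := hkey _ (by linarith) (by linarith) hsin
      rcases abs_choice (θ - θ₀) with h | h
      · left
        rw [Metric.mem_ball, Real.dist_eq, abs_lt]
        constructor <;> linarith
      · right
        rw [Metric.mem_ball, Real.dist_eq, abs_lt]
        constructor <;> linarith
  calc volume S ≤ _ := measure_mono hsub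
    _ ≤ volume (Metric.ball θ₀ κ) + (volume (Metric.ball (θ₀ + 2 * Real.pi) κ) +
        volume (Metric.ball (θ₀ - 2 * Real.pi) κ)) :=
      (measure_union_le _ _).trans (by gcongr; exact measure_union_le _ _)
    _ = _ := by
      rw [Real.volume_ball, Real.volume_ball, Real.volume_ball,
        ← ENNReal.ofReal_add (by positivity) (by positivity),
        ← ENNReal.ofReal_add (by positivity) (by positivity), hκ]
      congr 1; ring

/-- The area of the part of a disc of radius `η` in an annulus is at most a constant times `η`
times the thickness of the annulus. -/
theorem volume_sector_le (w : ℂ) (η r₁ r₂ : ℝ) :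
    volume {z : ℂ | ‖z‖ ∈ Set.Icc r₁ r₂ ∧ dist z w < η} ≤
      ENNReal.ofReal (6 * Real.pi * η) * ENNReal.ofReal (r₂ - r₁) := by
  set S := {z : ℂ | ‖z‖ ∈ Set.Icc r₁ r₂ ∧ dist z w < η}
  have hS : MeasurableSet S :=
    (measurableSet_Icc.preimage measurable_norm).inter Metric.isOpen_ball.measurableSet
  rw [← lintegral_indicator_one hS, lintegral_eq_lintegral_circleMap 0
    (measurable_one.indicator hS)]
  calc _ ≤ ∫⁻ r in Set.Ioi (0 : ℝ), (Set.Icc r₁ r₂).indicator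
        (fun _ => ENNReal.ofReal (6 * Real.pi * η)) r := by
        refine setLIntegral_mono' measurableSet_Ioi fun r hr => ?_
        have hr : 0 < r := hr
        by_cases hrI : r ∈ Set.Icc r₁ r₂
        · rw [Set.indicator_of_mem hrI]
          have hA : MeasurableSet {θ : ℝ | dist (circleMap 0 r θ) w < η} :=
            measurableSet_lt (by fun_prop) measurable_const
          calc _ = ENNReal.ofReal r *
                ∫⁻ θ in Set.Ioo (-Real.pi) Real.pi,
                  {θ : ℝ | dist (circleMap 0 r θ) w < η}.indicator 1 θ := by
                congr 1
                refine lintegral_congr fun θ => ?_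
                by_cases h : dist (circleMap 0 r θ) w < η
                · have h1 : circleMap 0 r θ ∈ S := ⟨by simpa [abs_of_pos hr] using hrI, h⟩
                  have h2 : θ ∈ {θ : ℝ | dist (circleMap 0 r θ) w < η} := h
                  rw [Set.indicator_of_mem h1, Set.indicator_of_mem h2]
                  rfl
                · have h1 : circleMap 0 r θ ∉ S := fun h' => h h'.2
                  have h2 : θ ∉ {θ : ℝ | dist (circleMap 0 r θ) w < η} := h
                  rw [Set.indicator_of_notMem h1, Set.indicator_of_notMem h2]
            _ = ENNReal.ofReal r *
                volume {θ ∈ Set.Ioo (-Real.pi) Real.pi | dist (circleMap 0 r θ) w < η} := by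
                rw [lintegral_indicator_one hA, Measure.restrict_apply hA, Set.inter_comm]
                rfl
            -- The Jacobian r cancels the 1/r of the arc bound, so the estimate is uniform in the
            -- radius.
            _ ≤ ENNReal.ofReal r * ENNReal.ofReal (6 * Real.pi * η / r) := by
                gcongr; exact volume_arc_le hr w
            _ = _ := by
                rw [← ENNReal.ofReal_mul hr.le]
                congr 1; field_simp
        · rw [Set.indicator_of_notMem hrI]
          have h0 : ∀ θ, S.indicator (1 : ℂ → ℝ≥0∞) (circleMap 0 r θ) = 0 := fun θ => by
            rw [Set.indicator_of_notMem]
            exact fun h => hrI (by simpa [abs_of_pos hr] using h.1)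
          simp [h0]
    _ ≤ ∫⁻ r, (Set.Icc r₁ r₂).indicator (fun _ => ENNReal.ofReal (6 * Real.pi * η)) r :=
        setLIntegral_le_lintegral _ _
    _ = _ := by
        rw [lintegral_indicator measurableSet_Icc, setLIntegral_const, Real.volume_Icc]

/-- Applied with exponent np - 2, for which the condition reads np > 1. -/
theorem lintegral_disc_rpow_lt_top {s : ℝ} (hs : -1 < s) :
    ∫⁻ z in disc, ENNReal.ofReal ((1 - ‖z‖) ^ s) < ∞ := by
  have hm : Measurable fun z : ℂ => ENNReal.ofReal ((1 - ‖z‖) ^ s) := by fun_prop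
  have hd : MeasurableSet disc := Metric.isOpen_ball.measurableSet
  rw [← lintegral_indicator hd, lintegral_eq_lintegral_circleMap 0 (hm.indicator hd)]
  have hint : IntegrableOn (fun r : ℝ => (1 - r) ^ s) (Set.Ioo 0 1) := by
    have h := (intervalIntegral.intervalIntegrable_rpow' (a := 0) (b := 1) hs).comp_sub_left 1
    rw [sub_zero, sub_self] at h
    exact ((intervalIntegrable_iff_integrableOn_Ioc_of_le zero_le_one).1 h.symm).mono_set
      Set.Ioo_subset_Ioc_self
  calc _ ≤ ∫⁻ r in Set.Ioi (0 : ℝ), (Set.Ioo (0 : ℝ) 1).indicator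
        (fun r => ENNReal.ofReal ((1 - r) ^ s) * ENNReal.ofReal (2 * Real.pi)) r := by
        refine setLIntegral_mono' measurableSet_Ioi fun r hr => ?_
        have hr : 0 < r := hr
        have hn : ∀ θ, ‖circleMap 0 r θ‖ = r := fun θ => by simp [abs_of_pos hr]
        by_cases hr1 : r < 1
        · rw [Set.indicator_of_mem (show r ∈ Set.Ioo (0 : ℝ) 1 from ⟨hr, hr1⟩)]
          have : ∀ θ, disc.indicator (fun z : ℂ => ENNReal.ofReal ((1 - ‖z‖) ^ s))
              (circleMap 0 r θ) = ENNReal.ofReal ((1 - r) ^ s) := fun θ => by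
            rw [Set.indicator_of_mem, hn]
            simp [disc, abs_of_pos hr, hr1]
          simp only [this, setLIntegral_const, Real.volume_Ioo]
          rw [sub_neg_eq_add, ← two_mul]
          exact mul_le_of_le_one_left' (ENNReal.ofReal_le_one.2 hr1.le)
        · have : ∀ θ, disc.indicator (fun z : ℂ => ENNReal.ofReal ((1 - ‖z‖) ^ s))
              (circleMap 0 r θ) = 0 := fun θ => by
            rw [Set.indicator_of_notMem]
            simpa [disc, abs_of_pos hr] using hr1
          simp [this]
    _ ≤ ∫⁻ r, (Set.Ioo (0 : ℝ) 1).indicator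
        (fun r => ENNReal.ofReal ((1 - r) ^ s) * ENNReal.ofReal (2 * Real.pi)) r :=
        setLIntegral_le_lintegral _ _
    _ < ∞ := by
        rw [lintegral_indicator measurableSet_Ioo, lintegral_mul_const' _ _ ENNReal.ofReal_ne_top]
        refine ENNReal.mul_lt_top ?_ ENNReal.ofReal_lt_top
        exact (hint.lintegral_lt_top)

/-! ### Power series in the disc -/

theorem differentiableOn_iteratedDeriv {f : ℂ → ℂ} (hf : DifferentiableOn ℂ f disc) (n : ℕ) :
    DifferentiableOn ℂ (iteratedDeriv n f) disc := by
  have h := (hf.analyticOnNhd Metric.isOpen_ball).iterated_deriv n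
  rw [← iteratedDeriv_eq_iterate] at h
  exact h.differentiableOn

theorem hasSum_iteratedDeriv {f : ℂ → ℂ} (hf : DifferentiableOn ℂ f disc) (n : ℕ) {z : ℂ}
    (hz : z ∈ disc) :
    HasSum (fun m : ℕ => (m.factorial : ℂ)⁻¹ * iteratedDeriv (m + n) f 0 * z ^ m)
      (iteratedDeriv n f z) := by
  have h := Complex.hasSum_taylorSeries_on_ball (differentiableOn_iteratedDeriv hf n) hz
  refine h.congr_fun ?_
  intro m
  simp only [iteratedDeriv_eq_iterate, Function.iterate_add_apply, sub_zero, smul_eq_mul]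
  ring

/-- A power series converging absolutely in the disc defines an analytic function with the
expected derivatives at the origin. -/
theorem differentiableOn_tsum_pow {c : ℕ → ℂ}
    (hc : ∀ r : ℝ, 0 ≤ r → r < 1 → Summable fun n => ‖c n‖ * r ^ n) :
    DifferentiableOn ℂ (fun z => ∑' n, c n * z ^ n) disc ∧
      ∀ n : ℕ, iteratedDeriv n (fun z => ∑' n, c n * z ^ n) 0 = n.factorial * c n := by
  set q := FormalMultilinearSeries.ofScalars ℂ c with hq
  have hrad : 1 ≤ q.radius := by
    refine ENNReal.le_of_forall_nnreal_lt fun r hr => ?_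
    refine q.le_radius_of_summable ?_
    have hr' : (r : ℝ) < 1 := by exact_mod_cast hr
    refine (hc r r.2 hr').congr fun n => ?_
    rw [hq, FormalMultilinearSeries.ofScalars_norm]
  have hsum : (fun z => ∑' n, c n * z ^ n) = q.sum := by
    funext z
    rw [hq]
    exact ((FormalMultilinearSeries.ofScalars_sum_eq c z).trans
      (tsum_congr fun n => smul_eq_mul _ _)).symm
  rw [hsum]
  have hball : HasFPowerSeriesOnBall q.sum q 0 1 :=
    (q.hasFPowerSeriesOnBall (lt_of_lt_of_le one_pos hrad)).mono one_pos hrad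
  refine ⟨?_, fun n => ?_⟩
  · have h := hball.differentiableOn
    rwa [← ENNReal.coe_one, Metric.eball_coe] at h
  · have h := congr_arg (FormalMultilinearSeries.coeff · n)
      ((hball.analyticAt.hasFPowerSeriesAt).eq_formalMultilinearSeries hball.hasFPowerSeriesAt)
    simp only [hq, FormalMultilinearSeries.coeff_ofScalars] at h
    rw [← h, mul_div_cancel₀ _ (by exact_mod_cast n.factorial_ne_zero)]

/-! ### Tails, moments and the averaging formula -/

section Weight

variable {μ : ℝ → ℝ}

theorem tail_eq_integral_Ioo {r : ℝ} (hr : r ≤ 1) : tail μ r = ∫ s in Set.Ioo r 1, μ s := by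
  rw [tail, intervalIntegral.integral_of_le hr, integral_Ioc_eq_integral_Ioo]

theorem moment_eq_integral_Ioo (k : ℕ) : moment μ k = ∫ s in Set.Ioo 0 1, s ^ k * μ s := by
  rw [moment, intervalIntegral.integral_of_le zero_le_one, integral_Ioc_eq_integral_Ioo]

variable (hμ : IsRadialWeight μ)
include hμ

theorem IsRadialWeight.integrableOn_Ioo {r : ℝ} (hr : 0 ≤ r) : IntegrableOn μ (Set.Ioo r 1) :=
  hμ.integrable.mono_set fun _ hs => ⟨hr.trans hs.1.le, hs.2⟩

theorem IsRadialWeight.integrableOn_pow_mul (k : ℕ) :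
    IntegrableOn (fun s => s ^ k * μ s) (Set.Ioo 0 1) := by
  refine Integrable.mono (hμ.integrableOn_Ioo le_rfl) (((continuous_pow k).aestronglyMeasurable).mul
    (hμ.integrableOn_Ioo le_rfl).aestronglyMeasurable) ?_
  refine (ae_restrict_iff' measurableSet_Ioo).2 (.of_forall fun s hs => ?_)
  rw [norm_mul, norm_pow, Real.norm_of_nonneg hs.1.le]
  exact mul_le_of_le_one_left (norm_nonneg _) (pow_le_one₀ hs.1.le hs.2.le)

theorem IsRadialWeight.tail_antitoneOn : AntitoneOn (tail μ) (Set.Icc 0 1) := by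
  intro a ha b hb hab
  rw [tail_eq_integral_Ioo ha.2, tail_eq_integral_Ioo hb.2]
  refine setIntegral_mono_set (hμ.integrableOn_Ioo ha.1) ?_
    (Set.Ioo_subset_Ioo_left hab).eventuallyLE
  exact (ae_restrict_iff' measurableSet_Ioo).2
    (.of_forall fun s hs => hμ.nonneg s ⟨ha.1.trans hs.1.le, hs.2⟩)

theorem IsRadialWeight.tail_pos' {r : ℝ} (hr : 0 ≤ r) (hr1 : r < 1) : 0 < tail μ r := by
  rcases hr.eq_or_lt with rfl | h
  · exact (hμ.tail_pos (1 / 2) (by norm_num)).trans_le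
      (hμ.tail_antitoneOn (by norm_num) (by norm_num) (by norm_num))
  · exact hμ.tail_pos r ⟨h, hr1⟩

theorem IsRadialWeight.pow_mul_tail_le_moment {r : ℝ} (hr : 0 ≤ r) (hr1 : r ≤ 1) (k : ℕ) :
    r ^ k * tail μ r ≤ moment μ k := by
  rw [tail_eq_integral_Ioo hr1, moment_eq_integral_Ioo, ← integral_const_mul]
  have hsub : Set.Ioo r 1 ⊆ Set.Ioo 0 1 := Set.Ioo_subset_Ioo_left hr
  calc ∫ s in Set.Ioo r 1, r ^ k * μ s ≤ ∫ s in Set.Ioo r 1, s ^ k * μ s := by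
        refine setIntegral_mono_on ((hμ.integrableOn_Ioo hr).const_mul _)
          ((hμ.integrableOn_pow_mul k).mono_set hsub) measurableSet_Ioo fun s hs => ?_
        exact mul_le_mul_of_nonneg_right (pow_le_pow_left₀ hr hs.1.le _)
          (hμ.nonneg s ⟨hr.trans hs.1.le, hs.2⟩)
    _ ≤ _ := by
        refine setIntegral_mono_set (hμ.integrableOn_pow_mul k) ?_ hsub.eventuallyLE
        exact (ae_restrict_iff' measurableSet_Ioo).2
          (.of_forall fun s hs => mul_nonneg (pow_nonneg hs.1.le _) (hμ.nonneg s ⟨hs.1.le, hs.2⟩))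

theorem IsRadialWeight.moment_pos (k : ℕ) : 0 < moment μ k :=
  lt_of_lt_of_le (mul_pos (by positivity) (hμ.tail_pos (1 / 2) (by norm_num)))
    (hμ.pow_mul_tail_le_moment (r := 1 / 2) (by norm_num) (by norm_num) k)

/-- With ρ = (1+r)/2 the moments satisfy μ_{2n+1} ≥ ρ^{2n+1} μ̂(ρ), so the series is dominated by a
multiple of the Taylor series of f at r/ρ². This point is in the disc because ρ² - r = (1-r)²/4 > 0.
-/
theorem IsRadialWeight.summable_fracDeriv {f : ℂ → ℂ} (hf : DifferentiableOn ℂ f disc)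
    {r : ℝ} (hr : 0 ≤ r) (hr1 : r < 1) :
    Summable fun n => ‖taylorCoeff f n / (moment μ (2 * n + 1) : ℂ)‖ * r ^ n := by
  set ρ := (1 + r) / 2 with hρ
  have hρ0 : 0 < ρ := by positivity
  have hρ1 : ρ < 1 := by rw [hρ]; linarith
  have hx1 : r / ρ ^ 2 < 1 := by
    rw [div_lt_one (by positivity), hρ]; nlinarith [mul_pos (sub_pos.2 hr1) (sub_pos.2 hr1)]
  have hx0 : 0 ≤ r / ρ ^ 2 := by positivity
  have ht := hμ.tail_pos ρ ⟨hρ0, hρ1⟩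
  have hx : ((r / ρ ^ 2 : ℝ) : ℂ) ∈ disc := by
    simpa only [disc, mem_ball_zero_iff, Complex.norm_real, Real.norm_of_nonneg hx0] using hx1
  have hs := (hasSum_iteratedDeriv hf 0 hx).summable.norm.mul_left (1 / (ρ * tail μ ρ))
  refine Summable.of_nonneg_of_le (fun n => by positivity) (fun n => ?_) hs
  have hm := hμ.pow_mul_tail_le_moment hρ0.le hρ1.le (2 * n + 1)
  have hm0 := hμ.moment_pos (2 * n + 1)
  rw [taylorCoeff, norm_div, Complex.norm_real, Real.norm_of_nonneg hm0.le, norm_mul, norm_pow,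
    Complex.norm_real, Real.norm_of_nonneg hx0, add_zero, ← div_eq_inv_mul, div_pow, ← pow_mul]
  calc _ ≤ ‖iteratedDeriv n f 0 / (n.factorial : ℂ)‖ / (ρ ^ (2 * n + 1) * tail μ ρ) * r ^ n := by
        gcongr
    _ = _ := by rw [pow_succ]; field_simp

theorem IsRadialWeight.differentiableOn_fracDeriv {f : ℂ → ℂ} (hf : DifferentiableOn ℂ f disc) :
    DifferentiableOn ℂ (fracDeriv μ f) disc :=
  (differentiableOn_tsum_pow fun _ h0 h1 => hμ.summable_fracDeriv hf h0 h1).1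

theorem IsRadialWeight.iteratedDeriv_zero_eq {f : ℂ → ℂ} (hf : DifferentiableOn ℂ f disc) (n : ℕ) :
    iteratedDeriv n f 0 = moment μ (2 * n + 1) * iteratedDeriv n (fracDeriv μ f) 0 := by
  have h := (differentiableOn_tsum_pow fun _ h0 h1 => hμ.summable_fracDeriv hf h0 h1).2 n
  change iteratedDeriv n (fracDeriv μ f) 0 = _ at h
  have hm : (moment μ (2 * n + 1) : ℂ) ≠ 0 := by exact_mod_cast (hμ.moment_pos _).ne'
  have hn : (n.factorial : ℂ) ≠ 0 := by exact_mod_cast n.factorial_ne_zero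
  rw [h, taylorCoeff]
  field_simp

/-- The derivatives of `f` are averages of the dilations of the derivatives of `D^μ(f)`. -/
theorem IsRadialWeight.iteratedDeriv_eq_integral {f : ℂ → ℂ} (hf : DifferentiableOn ℂ f disc)
    (n : ℕ) {z : ℂ} (hz : z ∈ disc) :
    iteratedDeriv n f z = ∫ s in Set.Ioo (0 : ℝ) 1,
      (s ^ (2 * n + 1) * μ s) • iteratedDeriv n (fracDeriv μ f) ((s : ℂ) ^ 2 * z) := by
  have hg := hμ.differentiableOn_fracDeriv hf
  set g := fracDeriv μ f with hgdef
  set a : ℕ → ℂ := fun m => (m.factorial : ℂ)⁻¹ * iteratedDeriv (m + n) g 0 * z ^ m with ha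
  have hsz := hasSum_iteratedDeriv hg n hz
  have hint : ∀ k : ℕ, ∀ b : ℂ, ∫ s in Set.Ioo (0 : ℝ) 1, (s ^ k * μ s) • b = moment μ k * b :=
    fun k b => by rw [integral_smul_const, moment_eq_integral_Ioo, Complex.real_smul]
  have hterm : ∀ m : ℕ, (m.factorial : ℂ)⁻¹ * iteratedDeriv (m + n) f 0 * z ^ m =
      ∫ s in Set.Ioo (0 : ℝ) 1, (s ^ (2 * (m + n) + 1) * μ s) • a m := fun m => by
    rw [hint, hμ.iteratedDeriv_zero_eq hf]
    ring
  -- Sum and integral may be exchanged: the m-th integral of norms is at most μ̂(0) times the m-th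
  -- term of the absolutely convergent series of g⁽ⁿ⁾(z).
  have hsumm := hasSum_integral_of_summable_integral_norm
    (F := fun (m : ℕ) (s : ℝ) => (s ^ (2 * (m + n) + 1) * μ s) • a m)
    (μ := volume.restrict (Set.Ioo (0 : ℝ) 1))
    (fun m => (hμ.integrableOn_pow_mul _).smul_const _) (by
      refine Summable.of_nonneg_of_le (fun m => integral_nonneg fun s => norm_nonneg _)
        (fun m => ?_) (hsz.summable.norm.mul_left (tail μ 0))
      rw [tail_eq_integral_Ioo zero_le_one, ← integral_mul_const]
      refine setIntegral_mono_on ((hμ.integrableOn_pow_mul _).smul_const _).norm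
        ((hμ.integrableOn_Ioo le_rfl).mul_const _) measurableSet_Ioo fun s hs => ?_
      have h0 := hμ.nonneg s ⟨hs.1.le, hs.2⟩
      rw [norm_smul, norm_mul, norm_pow, Real.norm_of_nonneg hs.1.le, Real.norm_of_nonneg h0]
      gcongr
      exact mul_le_of_le_one_left h0 (pow_le_one₀ hs.1.le hs.2.le))
  rw [(hasSum_iteratedDeriv hf n hz).unique (by simpa only [hterm] using hsumm)]
  refine setIntegral_congr_fun measurableSet_Ioo fun s hs => ?_
  have hsz' : (s : ℂ) ^ 2 * z ∈ disc := by
    have hz' : ‖z‖ < 1 := by simpa [disc] using hz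
    have : ‖(s : ℂ) ^ 2 * z‖ < 1 := by
      rw [norm_mul, norm_pow, Complex.norm_real, Real.norm_of_nonneg hs.1.le]
      nlinarith [norm_nonneg z, pow_le_one₀ hs.1.le hs.2.le (n := 2), sq_nonneg s]
    simpa [disc] using this
  have hs2 := (hasSum_iteratedDeriv hg n hsz').const_smul (s ^ (2 * n + 1) * μ s)
  rw [← hs2.tsum_eq]
  refine tsum_congr fun m => ?_
  simp only [ha, Complex.real_smul]
  push_cast
  ring

end Weight

/-! ### Decomposition of the average into geometric scales -/

/-- If S is the weighted sum on the right, each term satisfies x_i ≤ q^{-i/p} S^{1/p}, and a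
geometric series remains. This covers p ≤ 1 and p > 1 together. -/
theorem exists_tsum_rpow_le {p q : ℝ} (hp : 0 < p) (hq : 1 < q) :
    ∃ C : ℝ, 0 < C ∧ ∀ x : ℕ → ℝ≥0∞,
      (∑' i, x i) ^ p ≤ ENNReal.ofReal C * ∑' i, ENNReal.ofReal (q ^ i) * x i ^ p := by
  have hq0 : 0 < q := one_pos.trans hq
  set b : ℝ := q ^ (-(1 / p)) with hb
  have hb0 : 0 < b := by positivity
  have hb1 : b < 1 := Real.rpow_lt_one_of_one_lt_of_neg hq (by simpa using hp)
  have hb1' : 0 < 1 - b := sub_pos.2 hb1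
  refine ⟨((1 - b)⁻¹) ^ p, by positivity, fun x => ?_⟩
  set S := ∑' i, ENNReal.ofReal (q ^ i) * x i ^ p
  have hx : ∀ i, x i ≤ ENNReal.ofReal (b ^ i) * S ^ (1 / p) := fun i => by
    have h1 : ENNReal.ofReal (q ^ i) * x i ^ p ≤ S := ENNReal.le_tsum i
    have h2 : x i ^ p ≤ ENNReal.ofReal ((q ^ i)⁻¹) * S := by
      calc x i ^ p = ENNReal.ofReal ((q ^ i)⁻¹) * (ENNReal.ofReal (q ^ i) * x i ^ p) := by
            rw [← mul_assoc, ← ENNReal.ofReal_mul (by positivity),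
              inv_mul_cancel₀ (by positivity), ENNReal.ofReal_one, one_mul]
        _ ≤ _ := by gcongr
    have h3 : ENNReal.ofReal ((q ^ i)⁻¹) = ENNReal.ofReal (b ^ i) ^ p := by
      rw [ENNReal.ofReal_rpow_of_pos (by positivity), hb, ← Real.rpow_natCast,
        ← Real.rpow_natCast, ← Real.rpow_mul hq0.le, ← Real.rpow_mul hq0.le, ← Real.rpow_neg hq0.le]
      congr 2; field_simp
    rw [← ENNReal.rpow_le_rpow_iff hp, ENNReal.mul_rpow_of_nonneg _ _ hp.le, ← ENNReal.rpow_mul,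
      one_div_mul_cancel hp.ne', ENNReal.rpow_one, ← h3]
    exact h2
  calc (∑' i, x i) ^ p ≤ (∑' i, ENNReal.ofReal (b ^ i) * S ^ (1 / p)) ^ p :=
        ENNReal.rpow_le_rpow (ENNReal.tsum_le_tsum hx) hp.le
    _ = _ := by
      rw [ENNReal.tsum_mul_right, ← ENNReal.ofReal_tsum_of_nonneg (fun i => by positivity)
        (summable_geometric_of_lt_one hb0.le hb1), tsum_geometric_of_lt_one hb0.le hb1,
        ENNReal.mul_rpow_of_nonneg _ _ hp.le, ← ENNReal.rpow_mul, one_div_mul_cancel hp.ne',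
        ENNReal.rpow_one, ENNReal.ofReal_rpow_of_pos (by positivity)]

theorem rpow_add_le_two_rpow_mul {p : ℝ} (hp : 0 < p) (a b : ℝ≥0∞) :
    (a + b) ^ p ≤ 2 ^ p * (a ^ p + b ^ p) := by
  have h : a + b ≤ 2 * max a b := by
    rw [two_mul]; exact add_le_add (le_max_left _ _) (le_max_right _ _)
  refine (ENNReal.rpow_le_rpow h hp.le).trans ?_
  rw [ENNReal.mul_rpow_of_nonneg _ _ hp.le]
  gcongr
  rcases max_choice a b with h | h <;> rw [h]
  · exact le_self_add
  · exact le_add_self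

/-- The points at distance comparable to `D` from the unit circle and from `z`. -/
def nearSet (D : ℝ) (z : ℂ) : Set ℂ :=
  {w | 4 / 5 * D ≤ 1 - ‖w‖ ∧ 1 - ‖w‖ ≤ 3 * D ∧ dist z w < 2 * D}

/-- At the first scale, s²|z| ≤ 1 - D. Otherwise 1 - s² ≥ (3/2)(1-s) > (24/25)D. Either margin, less
D/10, still exceeds 4D/5, the value that has to match the left endpoint of the range of s. -/
theorem norm_le_of_mem_closedBall_dilation {z w : ℂ} {s D : ℝ} (hz : ‖z‖ < 1)
    (hs : 1 / 2 ≤ s) (hs1 : s < 1) (hD : 1 - ‖z‖ ≤ D)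
    (h : D = 1 - ‖z‖ ∨ 16 / 25 * D < 1 - s)
    (hw : w ∈ Metric.closedBall ((s : ℂ) ^ 2 * z) (D / 10)) : ‖w‖ ≤ 1 - 4 / 5 * D := by
  have hw' : ‖w - (s : ℂ) ^ 2 * z‖ ≤ D / 10 := by simpa [dist_eq_norm] using hw
  have hn : ‖(s : ℂ) ^ 2 * z‖ = s ^ 2 * ‖z‖ := by
    rw [norm_mul, norm_pow, Complex.norm_real, Real.norm_of_nonneg (by linarith)]
  have h1 : ‖w‖ ≤ s ^ 2 * ‖z‖ + D / 10 := by
    have := norm_add_le (w - (s : ℂ) ^ 2 * z) ((s : ℂ) ^ 2 * z)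
    rw [sub_add_cancel, hn] at this
    linarith
  have hz0 := norm_nonneg z
  have hs2 : s ^ 2 ≤ 1 := by nlinarith
  rcases h with h | h
  · nlinarith
  · have h2 : s ^ 2 * ‖z‖ ≤ s ^ 2 := by nlinarith [sq_nonneg s]
    nlinarith

/-- Here |z - s²z| ≤ 1 - s² ≤ 2(1-s) ≤ 8D/5, and adding D/10 stays below 2D. Together with 1-|z| ≤ D
this gives 1-|w| ≤ 3D. -/
theorem ball_dilation_subset_nearSet {z : ℂ} {s D : ℝ} (hz : ‖z‖ < 1)
    (hs : 1 / 2 ≤ s) (hs1 : s < 1) (hD : 1 - ‖z‖ ≤ D) (hsD : 1 - s ≤ 4 / 5 * D)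
    (h : D = 1 - ‖z‖ ∨ 16 / 25 * D < 1 - s) :
    Metric.ball ((s : ℂ) ^ 2 * z) (D / 10) ⊆ nearSet D z := by
  intro w hw
  have h0 := norm_le_of_mem_closedBall_dilation hz hs hs1 hD h (Metric.ball_subset_closedBall hw)
  have hw' : ‖w - (s : ℂ) ^ 2 * z‖ < D / 10 := by simpa [dist_eq_norm] using hw
  have hz0 := norm_nonneg z
  have h1 : ‖z - (s : ℂ) ^ 2 * z‖ ≤ 8 / 5 * D := by
    have h2 : z - (s : ℂ) ^ 2 * z = ((1 - s ^ 2 : ℝ) : ℂ) * z := by push_cast; ring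
    rw [h2, norm_mul, Complex.norm_real, Real.norm_of_nonneg (by nlinarith)]
    have h5 : 0 ≤ 1 - s ^ 2 := by nlinarith
    calc (1 - s ^ 2) * ‖z‖ ≤ 1 - s ^ 2 := mul_le_of_le_one_right h5 hz.le
      _ ≤ 8 / 5 * D := by nlinarith
  have h3 : ‖z - w‖ < 2 * D := by
    have h4 : z - w = (z - (s : ℂ) ^ 2 * z) - (w - (s : ℂ) ^ 2 * z) := by ring
    rw [h4]
    linarith [norm_sub_le (z - (s : ℂ) ^ 2 * z) (w - (s : ℂ) ^ 2 * z)]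
  refine ⟨by linarith, ?_, by rwa [dist_eq_norm]⟩
  linarith [norm_sub_norm_le z w]

section Weight

variable {μ : ℝ → ℝ}

theorem IsRadialWeight.tail_nonneg (hμ : IsRadialWeight μ) {r : ℝ} (hr : 0 ≤ r) (hr1 : r ≤ 1) :
    0 ≤ tail μ r := by
  rw [tail_eq_integral_Ioo hr1]
  exact setIntegral_nonneg measurableSet_Ioo fun s hs => hμ.nonneg s ⟨hr.trans hs.1.le, hs.2⟩

theorem IsRadialWeight.lintegral_Ico_eq_tail (hμ : IsRadialWeight μ) {r : ℝ} (hr : 0 ≤ r)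
    (hr1 : r ≤ 1) : ∫⁻ s in Set.Ico r 1, ENNReal.ofReal (μ s) = ENNReal.ofReal (tail μ r) := by
  rw [tail_eq_integral_Ioo hr1, ← integral_Ico_eq_integral_Ioo, ofReal_integral_eq_lintegral_ofReal]
  · exact hμ.integrable.mono_set (Set.Ico_subset_Ico_left hr)
  · exact (ae_restrict_iff' measurableSet_Ico).2
      (.of_forall fun s hs => hμ.nonneg s ⟨hr.trans hs.1, hs.2⟩)

/-- If `F` is bounded on a set `J ⊆ [r, 1)` in terms of the tail at `r`, its weighted integral
over `J` is controlled. -/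
theorem IsRadialWeight.lintegral_mul_le (hμ : IsRadialWeight μ) {r : ℝ} (hr : 0 ≤ r) (hr1 : r < 1)
    {J : Set ℝ} (hJ : MeasurableSet J) (hJr : J ⊆ Set.Ico r 1) {F : ℝ → ℝ≥0∞} {X : ℝ≥0∞}
    (hF : ∀ s ∈ J, F s * ENNReal.ofReal (tail μ r) ≤ X) :
    ∫⁻ s in J, ENNReal.ofReal (μ s) * F s ≤ X := by
  set T := ENNReal.ofReal (tail μ r) with hT
  have hT0 : T ≠ 0 := by simpa [hT] using hμ.tail_pos' hr hr1
  have hTt : T ≠ ∞ := ENNReal.ofReal_ne_top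
  have hm : AEMeasurable (fun s => ENNReal.ofReal (μ s)) (volume.restrict J) :=
    (hμ.integrable.mono_set
      (hJr.trans (Set.Ico_subset_Ico_left hr))).aestronglyMeasurable.aemeasurable.ennreal_ofReal
  calc ∫⁻ s in J, ENNReal.ofReal (μ s) * F s
      ≤ ∫⁻ s in J, ENNReal.ofReal (μ s) * (X / T) := by
        refine setLIntegral_mono' hJ fun s hs => ?_
        gcongr
        rw [ENNReal.le_div_iff_mul_le (Or.inl hT0) (Or.inl hTt)]
        exact hF s hs
    _ = (∫⁻ s in J, ENNReal.ofReal (μ s)) * (X / T) := lintegral_mul_const'' _ hm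
    _ ≤ T * (X / T) := by
        gcongr
        rw [hT, ← hμ.lintegral_Ico_eq_tail hr hr1.le]
        exact lintegral_mono_set hJr
    _ ≤ X := ENNReal.mul_div_le

/-- The geometric decomposition of the weighted integral of the dilations of a derivative. -/
theorem IsRadialWeight.exists_lintegral_dilation_le (hμ : IsRadialWeight μ) {p : ℝ} (hp : 0 < p)
    (n : ℕ) : ∃ C : ℝ, 0 < C ∧ ∀ g : ℂ → ℂ, DifferentiableOn ℂ g disc → ∀ z : ℂ, ‖z‖ < 1 →
      ∫⁻ s in Set.Ico (1 / 2 : ℝ) 1,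
          ENNReal.ofReal (μ s) * ‖iteratedDeriv n g ((s : ℂ) ^ 2 * z)‖ₑ ≤
        ∑' i : ℕ, (ENNReal.ofReal (C * ((5 / 4) ^ i * (1 - ‖z‖)) ^ (-(n * p + 2))) *
          ∫⁻ w in disc, (nearSet ((5 / 4) ^ i * (1 - ‖z‖)) z).indicator
            (fun w => ENNReal.ofReal (‖g w‖ ^ p * tail μ ‖w‖ ^ p)) w) ^ (1 / p) := by
  obtain ⟨C, hC, hCg⟩ := exists_rpow_enorm_iteratedDeriv_le hp n
  -- The power of 10 comes from the radius D_i/10.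
  refine ⟨C * 10 ^ (n * p + 2), by positivity, fun g hg z hz => ?_⟩
  have ht : 0 < 1 - ‖z‖ := sub_pos.2 hz
  have ht1 : 1 - ‖z‖ ≤ 1 := by linarith [norm_nonneg z]
  set D : ℕ → ℝ := fun i => (5 / 4) ^ i * (1 - ‖z‖) with hD
  have hDt : ∀ i, 1 - ‖z‖ ≤ D i := fun i =>
    le_mul_of_one_le_left ht.le (one_le_pow₀ (by norm_num))
  have hD0 : D 0 = 1 - ‖z‖ := by simp [hD]
  have hDs : ∀ i, D (i + 1) = 5 / 4 * D i := fun i => by simp only [hD, pow_succ]; ring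
  set J : ℕ → Set ℝ := fun i => {s | s ∈ Set.Ico (1 / 2 : ℝ) 1 ∧ 1 - s ≤ 4 / 5 * D i ∧
    (i = 0 ∨ 16 / 25 * D i < 1 - s)} with hJ
  have hJm : ∀ i, MeasurableSet (J i) := fun i =>
    measurableSet_Ico.inter
      ((measurableSet_le (f := fun s : ℝ => 1 - s) (by fun_prop) measurable_const).inter
        ((MeasurableSet.const _).union
          (measurableSet_lt (g := fun s : ℝ => 1 - s) measurable_const (by fun_prop))))
  have hcover : Set.Ico (1 / 2 : ℝ) 1 ⊆ ⋃ i, J i := by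
    intro s hs
    have hex : ∃ i, 1 - s ≤ 4 / 5 * D i := by
      obtain ⟨i, hi⟩ := pow_unbounded_of_one_lt ((1 - s) / (4 / 5 * (1 - ‖z‖)))
        (by norm_num : (1 : ℝ) < 5 / 4)
      rw [div_lt_iff₀ (by positivity)] at hi
      exact ⟨i, by simp only [hD]; linarith⟩
    classical
    -- Take the first admissible scale; failure at the preceding one gives 1-s > (4/5)²D_i, the
    -- source of 16/25.
    refine Set.mem_iUnion.2 ⟨Nat.find hex, hs, Nat.find_spec hex, ?_⟩
    rcases hi : Nat.find hex with _ | k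
    · exact Or.inl rfl
    · right
      have := Nat.find_min hex (m := k) (by omega)
      rw [hDs]; linarith
  refine (lintegral_mono_set hcover).trans ((lintegral_iUnion_le _ _).trans
    (ENNReal.tsum_le_tsum fun i => ?_))
  -- Nonemptiness forces 1 - 4D_i/5 ≥ 0; at larger scales this radius would leave [0, 1).
  rcases (J i).eq_empty_or_nonempty with he | ⟨s₀, hs₀, hs₀D, hs₀i⟩
  · rw [he]; simp
  have hcase : ∀ s ∈ J i, D i = 1 - ‖z‖ ∨ 16 / 25 * D i < 1 - s := fun s hs => by
    rcases hs.2.2 with h | h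
    · left; rw [h, hD0]
    · exact Or.inr h
  have hDi0 : 0 < D i := ht.trans_le (hDt i)
  have hr0 : 0 ≤ 1 - 4 / 5 * D i := by
    rcases hcase s₀ ⟨hs₀, hs₀D, hs₀i⟩ with h | h
    · linarith
    · linarith [hs₀.1]
  refine hμ.lintegral_mul_le hr0 (by linarith) (hJm i)
    (fun s hs => ⟨by linarith [hs.2.1], hs.1.2⟩) fun s hs => ?_
  have hin : ∀ w ∈ Metric.closedBall ((s : ℂ) ^ 2 * z) (D i / 10), ‖w‖ ≤ 1 - 4 / 5 * D i :=
    fun w hw => norm_le_of_mem_closedBall_dilation hz hs.1.1 hs.1.2 (hDt i) (hcase s hs) hw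
  have hdisc : Metric.closedBall ((s : ℂ) ^ 2 * z) (D i / 10) ⊆ disc := fun w hw => by
    rw [disc, mem_ball_zero_iff]; linarith [hin w hw]
  have hnear := ball_dilation_subset_nearSet hz hs.1.1 hs.1.2 (hDt i) hs.2.1 (hcase s hs)
  rw [← ENNReal.rpow_le_rpow_iff hp, ← ENNReal.rpow_mul, one_div_mul_cancel hp.ne',
    ENNReal.rpow_one, ENNReal.mul_rpow_of_nonneg _ _ hp.le]
  set T := tail μ (1 - 4 / 5 * D i) with hT
  have hT0 : 0 ≤ T := hμ.tail_nonneg hr0 (by linarith)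
  calc _ ≤ ENNReal.ofReal (C * (D i / 10) ^ (-(n * p + 2))) *
        (∫⁻ w in Metric.ball ((s : ℂ) ^ 2 * z) (D i / 10), ‖g w‖ₑ ^ p) * ENNReal.ofReal T ^ p := by
        gcongr
        exact hCg g _ _ (by positivity) (hg.mono hdisc)
    _ = ENNReal.ofReal (C * 10 ^ (n * p + 2) * (D i) ^ (-(n * p + 2))) *
        ∫⁻ w in Metric.ball ((s : ℂ) ^ 2 * z) (D i / 10), ‖g w‖ₑ ^ p * ENNReal.ofReal T ^ p := by
        rw [lintegral_mul_const' _ _ (by finiteness), mul_assoc,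
          Real.div_rpow hDi0.le (by norm_num), Real.rpow_neg (by norm_num : (0 : ℝ) ≤ 10),
          div_inv_eq_mul]
        congr 2; ring
    _ ≤ _ := by
        refine mul_le_mul_right ?_ _
        rw [← lintegral_indicator Metric.isOpen_ball.measurableSet,
          ← lintegral_indicator (s := disc) (by exact Metric.isOpen_ball.measurableSet)]
        refine lintegral_mono fun w => ?_
        by_cases hw : w ∈ Metric.ball ((s : ℂ) ^ 2 * z) (D i / 10)
        · rw [Set.indicator_of_mem hw, Set.indicator_of_mem
            (hdisc (Metric.ball_subset_closedBall hw)), Set.indicator_of_mem (hnear hw),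
            ENNReal.ofReal_mul (by positivity), ← ENNReal.ofReal_rpow_of_nonneg (norm_nonneg _) hp.le,
            ofReal_norm]
          have hwn := hin w (Metric.ball_subset_closedBall hw)
          have hTw : T ≤ tail μ ‖w‖ := hμ.tail_antitoneOn ⟨norm_nonneg _, by linarith⟩
            ⟨hr0, by linarith⟩ hwn
          rw [ENNReal.ofReal_rpow_of_nonneg hT0 hp.le]
          gcongr
        · rw [Set.indicator_of_notMem hw]; exact zero_le

/-- The derivatives of `D^μ(f)` near the origin are controlled by the norm of `f`. -/
theorem IsRadialWeight.exists_rpow_iteratedDeriv_origin_le (hμ : IsRadialWeight μ) {p : ℝ}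
    (hp : 0 < p) (n : ℕ) : ∃ C : ℝ, 0 < C ∧ ∀ g : ℂ → ℂ, DifferentiableOn ℂ g disc →
      ∀ u : ℂ, ‖u‖ ≤ 1 / 4 → ‖iteratedDeriv n g u‖ₑ ^ p ≤ ENNReal.ofReal C *
        ∫⁻ z in disc, ENNReal.ofReal (‖g z‖ ^ p * (tail μ ‖z‖ ^ p / (1 - ‖z‖ ^ 2) ^ 2)) := by
  obtain ⟨C, hC, hCg⟩ := exists_rpow_enorm_iteratedDeriv_le hp n
  have hT := hμ.tail_pos' (r := 1 / 2) (by norm_num) (by norm_num)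
  -- Discs of radius 1/4 about u stay in |w| ≤ 1/2, where the weight is at least T^p.
  set T := tail μ (1 / 2) with hTdef
  refine ⟨C * (1 / 4) ^ (-(n * p + 2)) * (T ^ p)⁻¹, by positivity, fun g hg u hu => ?_⟩
  have hsub : ∀ w ∈ Metric.closedBall u (1 / 4), ‖w‖ ≤ 1 / 2 := fun w hw => by
    have h1 : ‖w - u‖ ≤ 1 / 4 := by simpa [dist_eq_norm] using hw
    have := norm_add_le (w - u) u
    rw [sub_add_cancel] at this
    linarith
  have hdisc : Metric.closedBall u (1 / 4) ⊆ disc := fun w hw => by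
    rw [disc, mem_ball_zero_iff]; linarith [hsub w hw]
  refine (hCg g u (1 / 4) (by norm_num) (hg.mono hdisc)).trans ?_
  rw [ENNReal.ofReal_mul (p := C * _) (by positivity), mul_assoc]
  gcongr
  rw [← lintegral_const_mul' _ _ ENNReal.ofReal_ne_top]
  refine (setLIntegral_mono' Metric.isOpen_ball.measurableSet fun w hw => ?_).trans
    (lintegral_mono_set (Metric.ball_subset_closedBall.trans hdisc))
  have hw2 := hsub w (Metric.ball_subset_closedBall hw)
  have hTw : T ≤ tail μ ‖w‖ := hμ.tail_antitoneOn ⟨norm_nonneg _, by linarith⟩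
    ⟨by norm_num, by norm_num⟩ hw2
  rw [← ofReal_norm, ENNReal.ofReal_rpow_of_nonneg (norm_nonneg _) hp.le,
    ← ENNReal.ofReal_mul (by positivity)]
  apply ENNReal.ofReal_le_ofReal
  have hTp : 0 < T ^ p := by positivity
  rw [← div_eq_inv_mul, le_div_iff₀ hTp]
  have hn := norm_nonneg w
  have hd : 0 < (1 - ‖w‖ ^ 2) ^ 2 := by
    have : 0 < 1 - ‖w‖ ^ 2 := by nlinarith
    positivity
  have hd1 : (1 - ‖w‖ ^ 2) ^ 2 ≤ 1 := by
    have : 0 ≤ 1 - ‖w‖ ^ 2 := by nlinarith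
    exact pow_le_one₀ this (by nlinarith)
  gcongr
  rw [le_div_iff₀ hd]
  calc T ^ p * (1 - ‖w‖ ^ 2) ^ 2 ≤ T ^ p * 1 := by gcongr
    _ ≤ _ := by rw [mul_one]; gcongr

end Weight

/-! ### Integration over the near sets and Tonelli -/

-- Let τ = 1-|w|, A = (5/4)^i and t = 1-|z|. The relevant z have t comparable to τ/A and lie within
-- 5τ/2 of w, a region of area at most a constant times τ·τ/A. The integrand is t^{-4} A^{-(np+2)},
-- at most a constant times τ^{-4} A^{4-(np+2)}. The product is τ^{-2} A^{-(np-1)} up to a constant,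
-- which decays in i when np > 1.
open scoped Classical in
theorem lintegral_nearSet_le {p : ℝ} {n : ℕ} (i : ℕ) {w : ℂ} (hw : w ∈ disc) :
    ∫⁻ z in disc, (if w ∈ nearSet ((5 / 4) ^ i * (1 - ‖z‖)) z then
        ENNReal.ofReal ((1 - ‖z‖) ^ (n * p - 2) *
          ((5 / 4) ^ i * (1 - ‖z‖)) ^ (-(n * p + 2))) else 0) ≤
      ENNReal.ofReal (2000 * Real.pi * (((5 / 4 : ℝ) ^ (-(n * p - 1))) ^ i)) *
        ENNReal.ofReal (((1 - ‖w‖) ^ 2)⁻¹) := by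
  have hτ : 0 < 1 - ‖w‖ := by
    rw [disc, mem_ball_zero_iff] at hw; linarith
  set τ := 1 - ‖w‖ with hτdef
  set A : ℝ := (5 / 4) ^ i with hA
  have hA0 : 0 < A := by positivity
  -- The factor 81 = 3⁴ comes from t ≥ τ/(3A).
  set K : ℝ := 81 * (τ ^ 4)⁻¹ * (A ^ 4 * A ^ (-(n * p + 2))) with hK
  have hK0 : 0 ≤ K := by positivity
  set S := {z : ℂ | ‖z‖ ∈ Set.Icc (1 - 5 / 4 * τ / A) (1 - τ / 3 / A) ∧ dist z w < 5 / 2 * τ}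
    with hS
  have hSm : MeasurableSet S :=
    (measurableSet_Icc.preimage measurable_norm).inter Metric.isOpen_ball.measurableSet
  calc _ ≤ ∫⁻ z in disc, S.indicator (fun _ => ENNReal.ofReal K) z := by
        refine setLIntegral_mono' Metric.isOpen_ball.measurableSet fun z hz => ?_
        split_ifs with h
        · obtain ⟨h1, h2, h3⟩ := h
          have ht : 0 < 1 - ‖z‖ := by
            rw [disc, mem_ball_zero_iff] at hz; linarith
          set t := 1 - ‖z‖ with htdef
          have hlo : τ / 3 / A ≤ t := by
            rw [div_le_iff₀ hA0]; linarith
          have hhi : t ≤ 5 / 4 * τ / A := by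
            rw [le_div_iff₀ hA0]; linarith
          have hz' : z ∈ S := ⟨⟨by linarith, by linarith⟩, by linarith⟩
          rw [Set.indicator_of_mem hz']
          apply ENNReal.ofReal_le_ofReal
          have h4 : t ^ (n * p - 2) * (A * t) ^ (-(n * p + 2)) =
              (t ^ 4)⁻¹ * A ^ (-(n * p + 2)) := by
            rw [Real.mul_rpow hA0.le ht.le, mul_left_comm, ← Real.rpow_add ht,
              show (n * p - 2 + -(n * p + 2) : ℝ) = -((4 : ℕ) : ℝ) by push_cast; ring,
              Real.rpow_neg ht.le, Real.rpow_natCast, mul_comm]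
          rw [h4, hK, ← mul_assoc]
          gcongr
          calc (t ^ 4)⁻¹ ≤ ((τ / 3 / A) ^ 4)⁻¹ := by gcongr
            _ = _ := by field_simp; norm_num
        · exact zero_le
    _ ≤ ∫⁻ z, S.indicator (fun _ => ENNReal.ofReal K) z := setLIntegral_le_lintegral _ _
    _ = ENNReal.ofReal K * volume S := by
        rw [lintegral_indicator hSm, setLIntegral_const]
    _ ≤ ENNReal.ofReal K * (ENNReal.ofReal (6 * Real.pi * (5 / 2 * τ)) *
          ENNReal.ofReal (1 - τ / 3 / A - (1 - 5 / 4 * τ / A))) := by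
        gcongr; exact volume_sector_le _ _ _ _
    _ ≤ _ := by
        have hAp : A ^ 4 * A ^ (-(n * p + 2)) / A = ((5 / 4 : ℝ) ^ (-(n * p - 1))) ^ i := by
          rw [div_eq_mul_inv, ← Real.rpow_natCast A 4, ← Real.rpow_neg_one, ← Real.rpow_add hA0,
            ← Real.rpow_add hA0, hA, ← Real.rpow_natCast, ← Real.rpow_natCast,
            ← Real.rpow_mul (by norm_num), ← Real.rpow_mul (by norm_num)]
          congr 1; push_cast; ring
        have hd : 1 - τ / 3 / A - (1 - 5 / 4 * τ / A) = 11 / 12 * τ / A := by ring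
        rw [hd, ← ENNReal.ofReal_mul (by positivity), ← ENNReal.ofReal_mul hK0,
          ← ENNReal.ofReal_mul (by positivity), ← hAp]
        apply ENNReal.ofReal_le_ofReal
        have hpi := Real.pi_pos
        have hB : 0 < A ^ 4 * A ^ (-(n * p + 2)) / A := by positivity
        calc K * (6 * Real.pi * (5 / 2 * τ) * (11 / 12 * τ / A))
            = (81 * 6 * 5 / 2 * 11 / 12) * (Real.pi * (A ^ 4 * A ^ (-(n * p + 2)) / A) *
                (τ ^ 2)⁻¹) := by rw [hK]; field_simp
          _ ≤ 2000 * (Real.pi * (A ^ 4 * A ^ (-(n * p + 2)) / A) * (τ ^ 2)⁻¹) := by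
              gcongr; norm_num
          _ = _ := by ring

theorem measurableSet_nearSet (i : ℕ) :
    MeasurableSet {x : ℂ × ℂ | x.2 ∈ nearSet ((5 / 4) ^ i * (1 - ‖x.1‖)) x.1} := by
  refine MeasurableSet.inter ?_ (MeasurableSet.inter ?_ ?_)
  · exact (isClosed_le (f := fun x : ℂ × ℂ => 4 / 5 * ((5 / 4) ^ i * (1 - ‖x.1‖)))
      (g := fun x => 1 - ‖x.2‖) (by fun_prop) (by fun_prop)).measurableSet
  · exact (isClosed_le (f := fun x : ℂ × ℂ => 1 - ‖x.2‖)
      (g := fun x => 3 * ((5 / 4) ^ i * (1 - ‖x.1‖))) (by fun_prop) (by fun_prop)).measurableSet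
  · exact (isOpen_lt (f := fun x : ℂ × ℂ => dist x.1 x.2)
      (g := fun x => 2 * ((5 / 4) ^ i * (1 - ‖x.1‖))) (by fun_prop) (by fun_prop)).measurableSet

section Tonelli

variable {G : ℂ → ℝ≥0∞} (hG : AEMeasurable G (volume.restrict disc))
include hG

theorem aemeasurable_nearSet_indicator (i : ℕ) :
    AEMeasurable (fun x : ℂ × ℂ => (nearSet ((5 / 4) ^ i * (1 - ‖x.1‖)) x.1).indicator G x.2)
      ((volume.restrict disc).prod (volume.restrict disc)) :=
  hG.comp_snd.indicator (measurableSet_nearSet i)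

open scoped Classical in
theorem lintegral_lintegral_nearSet_le {p : ℝ} {n : ℕ} (i : ℕ) :
    ∫⁻ z in disc, ENNReal.ofReal ((1 - ‖z‖) ^ (n * p - 2) *
        ((5 / 4) ^ i * (1 - ‖z‖)) ^ (-(n * p + 2))) *
          ∫⁻ w in disc, (nearSet ((5 / 4) ^ i * (1 - ‖z‖)) z).indicator G w ≤
      ENNReal.ofReal (2000 * Real.pi * (((5 / 4 : ℝ) ^ (-(n * p - 1))) ^ i)) *
        ∫⁻ w in disc, ENNReal.ofReal (((1 - ‖w‖) ^ 2)⁻¹) * G w := by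
  set V : ℂ → ℝ≥0∞ := fun z => ENNReal.ofReal ((1 - ‖z‖) ^ (n * p - 2) *
        ((5 / 4) ^ i * (1 - ‖z‖)) ^ (-(n * p + 2))) with hV
  have hVm : Measurable V := by fun_prop
  calc ∫⁻ z in disc, V z * ∫⁻ w in disc, (nearSet ((5 / 4) ^ i * (1 - ‖z‖)) z).indicator G w
      = ∫⁻ z in disc, ∫⁻ w in disc, V z * (nearSet ((5 / 4) ^ i * (1 - ‖z‖)) z).indicator G w :=
        lintegral_congr fun z => (lintegral_const_mul' _ _ ENNReal.ofReal_ne_top).symm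
    _ = ∫⁻ w in disc, ∫⁻ z in disc, V z * (nearSet ((5 / 4) ^ i * (1 - ‖z‖)) z).indicator G w :=
        lintegral_lintegral_swap
          ((hVm.comp measurable_fst).aemeasurable.mul (aemeasurable_nearSet_indicator hG i))
    _ = ∫⁻ w in disc, ∫⁻ z in disc,
          (if w ∈ nearSet ((5 / 4) ^ i * (1 - ‖z‖)) z then V z else 0) * G w := by
        refine lintegral_congr fun w => lintegral_congr fun z => ?_
        by_cases h : w ∈ nearSet ((5 / 4) ^ i * (1 - ‖z‖)) z
        · rw [Set.indicator_of_mem h, if_pos h]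
        · rw [Set.indicator_of_notMem h, if_neg h, mul_zero, zero_mul]
    _ ≤ ∫⁻ w in disc, ENNReal.ofReal (2000 * Real.pi * (((5 / 4 : ℝ) ^ (-(n * p - 1))) ^ i)) *
          (ENNReal.ofReal (((1 - ‖w‖) ^ 2)⁻¹) * G w) := by
        refine setLIntegral_mono' Metric.isOpen_ball.measurableSet fun w hw => ?_
        have hm : Measurable fun z =>
            if w ∈ nearSet ((5 / 4) ^ i * (1 - ‖z‖)) z then V z else 0 :=
          Measurable.ite ((measurableSet_nearSet i).preimage (measurable_id.prodMk measurable_const))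
            hVm measurable_const
        rw [lintegral_mul_const _ hm, ← mul_assoc]
        gcongr
        exact lintegral_nearSet_le i hw
    _ = _ := lintegral_const_mul' _ _ ENNReal.ofReal_ne_top

end Tonelli

/-! ### The main weighted estimate -/

section Weight

variable {μ : ℝ → ℝ} (hμ : IsRadialWeight μ)
include hμ

theorem IsRadialWeight.aemeasurable_enorm_rpow_mul_tail {p : ℝ} {g : ℂ → ℂ}
    (hg : DifferentiableOn ℂ g disc) :
    AEMeasurable (fun w => ENNReal.ofReal (‖g w‖ ^ p * tail μ ‖w‖ ^ p))
      (volume.restrict disc) := by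
  have hd : MeasurableSet disc := Metric.isOpen_ball.measurableSet
  have h1 : AEMeasurable g (volume.restrict disc) := hg.continuousOn.aemeasurable hd
  have h2 : AEMeasurable (fun w : ℂ => tail μ ‖w‖) (volume.restrict disc) := by
    -- Clamping to [0, 1] makes the tail antitone on the whole line, hence Borel measurable.
    set T : ℝ → ℝ := fun r => tail μ (max 0 (min r 1)) with hT
    have hanti : Antitone T := fun a b hab => hμ.tail_antitoneOn
      ⟨le_max_left _ _, max_le zero_le_one (min_le_right _ _)⟩
      ⟨le_max_left _ _, max_le zero_le_one (min_le_right _ _)⟩ (by gcongr)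
    refine (hanti.measurable.comp measurable_norm).aemeasurable.congr ?_
    refine (ae_restrict_iff' hd).2 (.of_forall fun w hw => ?_)
    have hw' : ‖w‖ < 1 := by simpa [disc] using hw
    simp [hT, min_eq_left hw'.le]
  exact ((h1.norm.pow_const p).mul (h2.pow_const p)).ennreal_ofReal

/-- The main estimate: the weighted area integral of the `p`-th power of the averages of the
dilations of a derivative of `g`. -/
theorem IsRadialWeight.exists_lintegral_rpow_dilation_le {p : ℝ} (hp : 0 < p) {n : ℕ}
    (hn : 1 < n * p) : ∃ C : ℝ, 0 < C ∧ ∀ g : ℂ → ℂ, DifferentiableOn ℂ g disc →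
      ∫⁻ z in disc, ENNReal.ofReal ((1 - ‖z‖) ^ (n * p - 2)) *
          (∫⁻ s in Set.Ico (1 / 2 : ℝ) 1,
            ENNReal.ofReal (μ s) * ‖iteratedDeriv n g ((s : ℂ) ^ 2 * z)‖ₑ) ^ p ≤
        ENNReal.ofReal C *
          ∫⁻ z in disc, ENNReal.ofReal (‖g z‖ ^ p * (tail μ ‖z‖ ^ p / (1 - ‖z‖ ^ 2) ^ 2)) := by
  -- Half of the decay np - 1 pays for q^i; the other half leaves the convergent ratio b = 1/q.
  set ε : ℝ := (n * p - 1) / 2 with hε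
  have hε0 : 0 < ε := by rw [hε]; linarith
  set q : ℝ := (5 / 4) ^ ε with hq
  have hq1 : 1 < q := Real.one_lt_rpow (by norm_num) hε0
  have hq0 : 0 < q := one_pos.trans hq1
  obtain ⟨C₁, hC₁, hdec⟩ := hμ.exists_lintegral_dilation_le hp n
  obtain ⟨C₂, hC₂, hsum⟩ := exists_tsum_rpow_le hp hq1
  set b : ℝ := q * (5 / 4) ^ (-(n * p - 1)) with hb
  have hbq : b = q⁻¹ := by
    rw [hb, hq, ← Real.rpow_add (by norm_num), ← Real.rpow_neg (by norm_num)]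
    congr 1; rw [hε]; ring
  have hb0 : 0 ≤ b := by positivity
  have hb1 : b < 1 := by rw [hbq]; exact inv_lt_one_of_one_lt₀ hq1
  have hb1' : 0 < 1 - b := sub_pos.2 hb1
  refine ⟨C₂ * (C₁ * (2000 * Real.pi) * (1 - b)⁻¹ * 4), by positivity, fun g hg => ?_⟩
  set G : ℂ → ℝ≥0∞ := fun w => ENNReal.ofReal (‖g w‖ ^ p * tail μ ‖w‖ ^ p) with hG
  have hGm : AEMeasurable G (volume.restrict disc) := hμ.aemeasurable_enorm_rpow_mul_tail hg
  set I := ∫⁻ z in disc, ENNReal.ofReal (‖g z‖ ^ p * (tail μ ‖z‖ ^ p / (1 - ‖z‖ ^ 2) ^ 2))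
  set Y : ℕ → ℂ → ℝ≥0∞ := fun i z => ∫⁻ w in disc,
    (nearSet ((5 / 4) ^ i * (1 - ‖z‖)) z).indicator G w with hY
  have hYm : ∀ i, AEMeasurable (Y i) (volume.restrict disc) := fun i =>
    (aemeasurable_nearSet_indicator hGm i).lintegral_prod_right'
  set U : ℕ → ℂ → ℝ≥0∞ := fun i z => ENNReal.ofReal ((1 - ‖z‖) ^ (n * p - 2) *
    ((5 / 4) ^ i * (1 - ‖z‖)) ^ (-(n * p + 2))) * Y i z with hU
  have hUm : ∀ i, AEMeasurable (U i) (volume.restrict disc) := fun i =>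
    (by fun_prop : Measurable fun z : ℂ => ENNReal.ofReal ((1 - ‖z‖) ^ (n * p - 2) *
      ((5 / 4) ^ i * (1 - ‖z‖)) ^ (-(n * p + 2)))).aemeasurable.mul (hYm i)
  have hpt : ∀ z ∈ disc, ENNReal.ofReal ((1 - ‖z‖) ^ (n * p - 2)) *
      (∫⁻ s in Set.Ico (1 / 2 : ℝ) 1,
        ENNReal.ofReal (μ s) * ‖iteratedDeriv n g ((s : ℂ) ^ 2 * z)‖ₑ) ^ p ≤
      ENNReal.ofReal C₂ * ∑' i, ENNReal.ofReal (q ^ i * C₁) * U i z := fun z hz => by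
    have hz1 : ‖z‖ < 1 := by simpa [disc] using hz
    have ht : 0 < 1 - ‖z‖ := sub_pos.2 hz1
    calc _ ≤ ENNReal.ofReal ((1 - ‖z‖) ^ (n * p - 2)) * (ENNReal.ofReal C₂ *
          ∑' i, ENNReal.ofReal (q ^ i) * ((ENNReal.ofReal (C₁ * ((5 / 4) ^ i *
            (1 - ‖z‖)) ^ (-(n * p + 2))) * Y i z) ^ (1 / p)) ^ p) := by
          gcongr
          exact (ENNReal.rpow_le_rpow (hdec g hg z hz1) hp.le).trans (hsum _)
      _ = _ := by
          rw [mul_left_comm, ← ENNReal.tsum_mul_left]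
          congr 1
          refine tsum_congr fun i => ?_
          rw [← ENNReal.rpow_mul, one_div_mul_cancel hp.ne', ENNReal.rpow_one, hU]
          dsimp only
          rw [ENNReal.ofReal_mul hC₁.le, ENNReal.ofReal_mul (p := q ^ i) (by positivity),
            ENNReal.ofReal_mul (p := (1 - ‖z‖) ^ (n * p - 2)) (by positivity)]
          ring
  -- The 4 comes from 1-|w|² ≤ 2(1-|w|).
  have hGI : ∫⁻ w in disc, ENNReal.ofReal (((1 - ‖w‖) ^ 2)⁻¹) * G w ≤ ENNReal.ofReal 4 * I := by
    rw [← lintegral_const_mul' _ _ ENNReal.ofReal_ne_top]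
    refine setLIntegral_mono' Metric.isOpen_ball.measurableSet fun w hw => ?_
    have hw1 : ‖w‖ < 1 := by simpa [disc] using hw
    have hw0 := norm_nonneg w
    have hτ : 0 < 1 - ‖w‖ := sub_pos.2 hw1
    have hT : 0 ≤ tail μ ‖w‖ := hμ.tail_nonneg hw0 hw1.le
    rw [hG, ← ENNReal.ofReal_mul (by positivity), ← ENNReal.ofReal_mul (by norm_num)]
    apply ENNReal.ofReal_le_ofReal
    have hd : 0 < 1 - ‖w‖ ^ 2 := by nlinarith
    have hd2 : 1 - ‖w‖ ^ 2 ≤ 2 * (1 - ‖w‖) := by nlinarith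
    have hinv : ((1 - ‖w‖) ^ 2)⁻¹ ≤ 4 * ((1 - ‖w‖ ^ 2) ^ 2)⁻¹ := by
      calc ((1 - ‖w‖) ^ 2)⁻¹ = 4 * ((2 * (1 - ‖w‖)) ^ 2)⁻¹ := by field_simp; norm_num
        _ ≤ _ := by gcongr
    calc _ ≤ 4 * ((1 - ‖w‖ ^ 2) ^ 2)⁻¹ * (‖g w‖ ^ p * tail μ ‖w‖ ^ p) := by gcongr
      _ = _ := by rw [div_eq_mul_inv]; ring
  calc _ ≤ ∫⁻ z in disc, ENNReal.ofReal C₂ * ∑' i, ENNReal.ofReal (q ^ i * C₁) * U i z :=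
        setLIntegral_mono' Metric.isOpen_ball.measurableSet hpt
    _ = ENNReal.ofReal C₂ * ∑' i, ENNReal.ofReal (q ^ i * C₁) * ∫⁻ z in disc, U i z := by
        rw [lintegral_const_mul' _ _ ENNReal.ofReal_ne_top,
          lintegral_tsum fun i => (hUm i).const_mul _]
        congr 1
        exact tsum_congr fun i => lintegral_const_mul' _ _ ENNReal.ofReal_ne_top
    _ ≤ ENNReal.ofReal C₂ * ∑' i, ENNReal.ofReal (C₁ * (2000 * Real.pi) * b ^ i) *
          (ENNReal.ofReal 4 * I) := by
        refine mul_le_mul_right (ENNReal.tsum_le_tsum fun i => ?_) _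
        refine (mul_le_mul_right ((lintegral_lintegral_nearSet_le hGm i).trans
          (mul_le_mul_right hGI _)) _).trans_eq ?_
        rw [← mul_assoc, ← ENNReal.ofReal_mul (by positivity)]
        congr 2
        rw [hb, mul_pow]; ring
    _ = _ := by
        rw [ENNReal.tsum_mul_right, ← ENNReal.ofReal_tsum_of_nonneg (fun i => by positivity)
          ((summable_geometric_of_lt_one hb0 hb1).mul_left _), tsum_mul_left,
          tsum_geometric_of_lt_one hb0 hb1, ← mul_assoc, ← mul_assoc,
          ← ENNReal.ofReal_mul hC₂.le, ← ENNReal.ofReal_mul (by positivity)]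
        congr 2; ring

end Weight

/-! ### Assembling the norm inequality -/

theorem one_lt_besovOrder_mul {p : ℝ} (hp : 0 < p) : 1 < (besovOrder p : ℝ) * p := by
  have hne : {n : ℕ | 1 < (n : ℝ) * p}.Nonempty := by
    obtain ⟨n, hn⟩ := exists_nat_gt (1 / p)
    exact ⟨n, (div_lt_iff₀ hp).1 hn⟩
  exact Nat.sInf_mem hne

section Weight

variable {μ : ℝ → ℝ} (hμ : IsRadialWeight μ)
include hμ

theorem IsRadialWeight.enorm_iteratedDeriv_le {f : ℂ → ℂ} (hf : DifferentiableOn ℂ f disc)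
    (n : ℕ) {z : ℂ} (hz : z ∈ disc) :
    ‖iteratedDeriv n f z‖ₑ ≤
      (∫⁻ s in Set.Ioo (0 : ℝ) (1 / 2),
        ENNReal.ofReal (μ s) * ‖iteratedDeriv n (fracDeriv μ f) ((s : ℂ) ^ 2 * z)‖ₑ) +
      ∫⁻ s in Set.Ico (1 / 2 : ℝ) 1,
        ENNReal.ofReal (μ s) * ‖iteratedDeriv n (fracDeriv μ f) ((s : ℂ) ^ 2 * z)‖ₑ := by
  rw [hμ.iteratedDeriv_eq_integral hf n hz]
  calc _ ≤ ∫⁻ s in Set.Ioo (0 : ℝ) 1,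
        ‖(s ^ (2 * n + 1) * μ s) • iteratedDeriv n (fracDeriv μ f) ((s : ℂ) ^ 2 * z)‖ₑ :=
        enorm_integral_le_lintegral_enorm _
    _ ≤ ∫⁻ s in Set.Ioo (0 : ℝ) 1,
        ENNReal.ofReal (μ s) * ‖iteratedDeriv n (fracDeriv μ f) ((s : ℂ) ^ 2 * z)‖ₑ := by
        refine setLIntegral_mono' measurableSet_Ioo fun s hs => ?_
        have h0 := hμ.nonneg s ⟨hs.1.le, hs.2⟩
        rw [enorm_smul, Real.enorm_of_nonneg (mul_nonneg (pow_nonneg hs.1.le _) h0)]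
        gcongr
        exact mul_le_of_le_one_left h0 (pow_le_one₀ hs.1.le hs.2.le)
    _ ≤ _ := by
        refine (lintegral_mono_set ?_).trans (lintegral_union_le _ _ _)
        intro s hs
        rcases lt_or_ge s (1 / 2) with h | h
        · exact Or.inl ⟨hs.1, h⟩
        · exact Or.inr ⟨h, hs.2⟩

theorem IsRadialWeight.exists_lintegral_iteratedDeriv_le {p : ℝ} (hp : 0 < p) {n : ℕ}
    (hn : 1 < n * p) : ∃ C : ℝ≥0∞, C ≠ ∞ ∧ ∀ f : ℂ → ℂ, DifferentiableOn ℂ f disc →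
      ∫⁻ z in disc, ENNReal.ofReal (‖iteratedDeriv n f z‖ ^ p * (1 - ‖z‖ ^ 2) ^ (n * p - 2)) ≤
        C * ∫⁻ z in disc, ENNReal.ofReal
          (‖fracDeriv μ f z‖ ^ p * (tail μ ‖z‖ ^ p / (1 - ‖z‖ ^ 2) ^ 2)) := by
  obtain ⟨C₀, hC₀, hlow⟩ := hμ.exists_rpow_iteratedDeriv_origin_le hp n
  obtain ⟨C₁, hC₁, hhigh⟩ := hμ.exists_lintegral_rpow_dilation_le hp hn
  set M := ∫⁻ z in disc, ENNReal.ofReal ((1 - ‖z‖) ^ (n * p - 2)) with hM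
  have hMfin : M < ∞ := lintegral_disc_rpow_lt_top (by linarith)
  set T := ENNReal.ofReal (tail μ 0) ^ p with hT
  have hTfin : T ≠ ∞ := by finiteness
  have h2p : (2 : ℝ≥0∞) ^ p ≠ ∞ := by finiteness
  refine ⟨ENNReal.ofReal (2 ^ |n * p - 2|) * (2 ^ p * (M * (ENNReal.ofReal C₀ * T) +
    ENNReal.ofReal C₁)), by finiteness, fun f hf => ?_⟩
  set g := fracDeriv μ f
  have hg : DifferentiableOn ℂ g disc := hμ.differentiableOn_fracDeriv hf
  set I := ∫⁻ z in disc, ENNReal.ofReal (‖g z‖ ^ p * (tail μ ‖z‖ ^ p / (1 - ‖z‖ ^ 2) ^ 2)) with hI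
  set B : ℂ → ℝ≥0∞ := fun z => ∫⁻ s in Set.Ico (1 / 2 : ℝ) 1,
    ENNReal.ofReal (μ s) * ‖iteratedDeriv n g ((s : ℂ) ^ 2 * z)‖ₑ with hB
  set V : ℂ → ℝ≥0∞ := fun z => ENNReal.ofReal ((1 - ‖z‖) ^ (n * p - 2)) with hV
  have hVm : Measurable V := by fun_prop
  have hpt : ∀ z ∈ disc, ‖iteratedDeriv n f z‖ₑ ^ p ≤
      2 ^ p * (ENNReal.ofReal C₀ * T * I + B z ^ p) := fun z hz => by
    have hz1 : ‖z‖ < 1 := by simpa [disc] using hz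
    refine (ENNReal.rpow_le_rpow (hμ.enorm_iteratedDeriv_le hf n hz) hp.le).trans
      ((rpow_add_le_two_rpow_mul hp _ _).trans ?_)
    gcongr
    -- For s < 1/2 the dilated point has modulus at most 1/4, so the bound near the origin is
    -- uniform in s and z; the mass of μ is bounded by μ̂(0).
    rw [← ENNReal.le_rpow_inv_iff hp]
    refine hμ.lintegral_mul_le le_rfl zero_lt_one measurableSet_Ioo
      (fun s hs => ⟨hs.1.le, by linarith [hs.2]⟩) fun s hs => ?_
    rw [ENNReal.le_rpow_inv_iff hp, ENNReal.mul_rpow_of_nonneg _ _ hp.le, mul_right_comm]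
    gcongr
    refine hlow g hg _ ?_
    rw [norm_mul, norm_pow, Complex.norm_real, Real.norm_of_nonneg hs.1.le]
    have : s ^ 2 ≤ 1 / 4 := by nlinarith [hs.1, hs.2]
    nlinarith [norm_nonneg z, sq_nonneg s]
  -- The exponent np - 2 may be negative, hence the absolute value in the constant.
  have hweight : ∀ z ∈ disc, (1 - ‖z‖ ^ 2) ^ (n * p - 2) ≤
      2 ^ |n * p - 2| * (1 - ‖z‖) ^ (n * p - 2) := fun z hz => by
    have hz1 : ‖z‖ < 1 := by simpa [disc] using hz
    have hz0 := norm_nonneg z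
    have ht : 0 < 1 - ‖z‖ := sub_pos.2 hz1
    have hfac : 1 - ‖z‖ ^ 2 = (1 + ‖z‖) * (1 - ‖z‖) := by ring
    rw [hfac, Real.mul_rpow (by positivity) ht.le]
    gcongr
    calc (1 + ‖z‖) ^ (n * p - 2) ≤ (1 + ‖z‖) ^ |n * p - 2| :=
          Real.rpow_le_rpow_of_exponent_le (by linarith) (le_abs_self _)
      _ ≤ _ := Real.rpow_le_rpow (by positivity) (by linarith) (abs_nonneg _)
  calc _ ≤ ∫⁻ z in disc, ENNReal.ofReal (2 ^ |n * p - 2|) *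
        (2 ^ p * (V z * (ENNReal.ofReal C₀ * T * I) + V z * B z ^ p)) := by
        refine setLIntegral_mono' Metric.isOpen_ball.measurableSet fun z hz => ?_
        rw [ENNReal.ofReal_mul (by positivity), ← ENNReal.ofReal_rpow_of_nonneg (norm_nonneg _)
          hp.le, ofReal_norm, ← mul_add, mul_left_comm (2 ^ p), mul_comm (_ ^ p), ← mul_assoc]
        refine mul_le_mul' ?_ (hpt z hz)
        rw [hV, ← ENNReal.ofReal_mul (by positivity)]
        exact ENNReal.ofReal_le_ofReal (hweight z hz)
    _ = ENNReal.ofReal (2 ^ |n * p - 2|) * (2 ^ p * ((∫⁻ z in disc, V z *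
          (ENNReal.ofReal C₀ * T * I)) + ∫⁻ z in disc, V z * B z ^ p)) := by
        rw [lintegral_const_mul' _ _ ENNReal.ofReal_ne_top, lintegral_const_mul' _ _ h2p,
          lintegral_add_left (hVm.mul_const _)]
    _ ≤ ENNReal.ofReal (2 ^ |n * p - 2|) * (2 ^ p * (M * (ENNReal.ofReal C₀ * T * I) +
          ENNReal.ofReal C₁ * I)) := by
        rw [lintegral_mul_const _ hVm]
        gcongr
        exact hhigh g hg
    _ = _ := by ring

theorem IsRadialWeight.exists_besovNormPow_le {p : ℝ} (hp : 0 < p) :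
    ∃ C : ℝ≥0, 0 < C ∧ ∀ f ∈ HolDisc, besovNormPow p f ≤ C * fracBesovNormPow p μ f := by
  obtain ⟨C, hC, hmain⟩ := hμ.exists_lintegral_iteratedDeriv_le hp (one_lt_besovOrder_mul hp)
  choose C₀ hC₀ hlow using fun j => hμ.exists_rpow_iteratedDeriv_origin_le hp j
  set K : ℝ≥0∞ := ∑ j ∈ Finset.range (besovOrder p),
    ENNReal.ofReal (moment μ (2 * j + 1)) ^ p * ENNReal.ofReal (C₀ j) * ENNReal.ofReal Real.pi
    with hK
  have hKfin : K ≠ ∞ := ENNReal.sum_ne_top.2 fun j _ => by finiteness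
  have hKC : K + C ≠ ∞ := by finiteness
  -- The added 1 only ensures that the constant is positive.
  refine ⟨(K + C).toNNReal + 1, by positivity, fun f hf => ?_⟩
  have hf : DifferentiableOn ℂ f disc := hf
  have hπ : ENNReal.ofReal Real.pi ≠ 0 := by simpa using Real.pi_pos
  refine le_trans (b := (K + C) * fracBesovNormPow p μ f) ?_ ?_
  · rw [besovNormPow, fracBesovNormPow, areaDisc, lintegral_smul_measure, lintegral_smul_measure,
      add_mul, smul_eq_mul, smul_eq_mul]
    set I := ∫⁻ z in disc, ENNReal.ofReal
      (‖fracDeriv μ f z‖ ^ p * (tail μ ‖z‖ ^ p / (1 - ‖z‖ ^ 2) ^ 2))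
    refine add_le_add ?_ ?_
    · rw [hK, Finset.sum_mul]
      refine Finset.sum_le_sum fun j _ => ?_
      rw [← ENNReal.ofReal_rpow_of_nonneg (norm_nonneg _) hp.le, ofReal_norm,
        hμ.iteratedDeriv_zero_eq hf, enorm_mul, ENNReal.mul_rpow_of_nonneg _ _ hp.le,
        mul_assoc, ← mul_assoc (ENNReal.ofReal Real.pi),
        ENNReal.mul_inv_cancel hπ ENNReal.ofReal_ne_top, one_mul, mul_assoc, ← ofReal_norm,
        Complex.norm_real, Real.norm_of_nonneg (hμ.moment_pos _).le]
      gcongr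
      exact hlow j _ (hμ.differentiableOn_fracDeriv hf) 0 (by norm_num)
    · rw [mul_left_comm]
      gcongr
      exact hmain f hf
  · gcongr
    rw [ENNReal.coe_add, ENNReal.coe_toNNReal hKC]
    exact le_self_add

end Weight

theorem fracBesovSpace_subset {p : ℝ} {μ : ℝ → ℝ} {C : ℝ≥0}
    (h : ∀ f ∈ HolDisc, besovNormPow p f ≤ C * fracBesovNormPow p μ f) :
    FracBesovSpace p μ ⊆ BesovSpace p := fun f hf =>
  ⟨hf.1, (h f hf.1).trans_lt (ENNReal.mul_lt_top ENNReal.coe_lt_top hf.2)⟩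

end FracBesov

theorem mainTheorem8 (p : ℝ) (μ : ℝ → ℝ) (hμ : FracBesov.IsRadialWeight μ) :
    (1 ≤ p →
      FracBesov.FracBesovSpace p μ ⊆ FracBesov.BesovSpace p ∧
      ∃ C : ℝ≥0, 0 < C ∧ ∀ f ∈ FracBesov.HolDisc,
        FracBesov.besovNormPow p f ≤ C * FracBesov.fracBesovNormPow p μ f) ∧
    (0 < p → p < 1 → μ ∈ FracBesov.UpperDoubling →
      FracBesov.FracBesovSpace p μ ⊆ FracBesov.BesovSpace p ∧
      ∃ C : ℝ≥0, 0 < C ∧ ∀ f ∈ FracBesov.HolDisc,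
        FracBesov.besovNormPow p f ≤ C * FracBesov.fracBesovNormPow p μ f) := by
  have key : 0 < p → FracBesov.FracBesovSpace p μ ⊆ FracBesov.BesovSpace p ∧
      ∃ C : ℝ≥0, 0 < C ∧ ∀ f ∈ FracBesov.HolDisc,
        FracBesov.besovNormPow p f ≤ C * FracBesov.fracBesovNormPow p μ f := fun hp => by
    obtain ⟨C, hC, h⟩ := hμ.exists_besovNormPow_le hp
    exact ⟨FracBesov.fracBesovSpace_subset h, C, hC, h⟩
  exact ⟨fun hp => key (one_pos.trans_le hp), fun hp _ _ => key hp⟩
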